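/- Let $\Omega=\mathbb{R}^{\mathbb{N}}$, $\mathbb{N}=\{0,1,2,\dots\}$, carry the probability measure $P$ under which the coordinates $U_k(\omega)=\omega_k$ are i.i.d. uniform on $[-1,1]$, and let $E$ be the expectation. For $t\ge 0$ let $\Psi_t(\omega)$ be the sequence obtained from $\omega$ by replacing the coordinate of index $\lfloor t/2\rfloor$ by $t-2\lfloor t/2\rfloor-1$. For $X\in L^2(\Omega)$ put $$\nabla_tX:=X\circ\Psi_t-\frac12\int_{2\lfloor t/2\rfloor}^{2\lfloor t/2\rfloor+2}X\circ\Psi_s\,ds,\qquad t\ge0,$$ $$\mathrm{Dom}(\nabla):=\Big\{X\in L^2(\Omega):\ E\Big[\int_0^\infty|\nabla_tX|^2\,dt\Big]<\infty\Big\}.$$ For $n\ge1$ let $\Delta_n$ be the union of the boxes $[2k_1,2k_1+2]\times\cdots\times[2k_n,2k_n+2]$ over pairwise distinct $k_1,\dots,k_n\in\mathbb{N}$. For a symmetric function $f\in L^1(\mathbb{R}_+^n)\cap L^2(\mathbb{R}_+^n)$ that vanishes outside $\Delta_n$, the multiple stochastic integral is $$I_n(f):=\sum_{r=0}^n\frac{(-1)^{n-r}}{2^{n-r}}\binom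 nr\sum_{k_1,\dots,k_r\text{ distinct}}\int_{\mathbb{R}_+^{n-r}}f(2k_1+1+U_{k_1},\dots,2k_r+1+U_{k_r},y_1,\dots,y_{n-r})\,dy_1\cdots dy_{n-r},$$ and the $n$-th chaos $\mathcal{C}_n$ is the closure in $L^2(\Omega)$ of the space of these integrals (equivalently, the space of the $I_n(f)$ for all square-integrable such $f$, $I_n$ being extended by continuity). The spaces $\mathcal{C}_n$ are mutually orthogonal, and every centered $X\in L^2(\Omega)$ is the sum in $L^2(\Omega)$ of its orthogonal projections $X_n$ on $\mathcal{C}_n$, $n\ge1$. The inverse of the Ornstein-Uhlenbeck operator ($L=-n$ on $\mathcal{C}_n$) is $$L^{-1}X:=-\sum_{n\ge1}\frac1n X_n .$$ Let $\mathcal N$ be the standard normal distribution, let $d_W(X,\mathcal N)=\sup_h|E[h(X)]-\int h\,d\mathcal N|$, the supremum being over all $h:\mathbb{R}\to\mathbb{R}$ with Lipschitz constant at most $1$, and let $\langle u,v\rangle=\int_0^\infty u_tv_t\,dt$. **Proposition.** Let $X\in\mathrm{Dom}(\nabla)$ with $E[X]=0$. Then the integral $\langle\nabla_\cdot X,-\nabla_\cdot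 L^{-1}X\rangle$ converges absolutely almost surely, and $$d_W(X,\mathcal N)\le E\Big[\Big|1-\frac12\langle\nabla_\cdot X,-\nabla_\cdot L^{-1}X\rangle\Big|\Big]+\frac12E\Big[\int_0^\infty|\nabla_tL^{-1}X|\,|\nabla_tX|^2\,dt\Big]+\frac14E\Big[\int_0^\infty|\nabla_tL^{-1}X|\int_{2\lfloor t/2\rfloor}^{2\lfloor t/2\rfloor+2}|\nabla_sX|^2\,ds\,dt\Big],$$ where the last two terms are allowed to be $+\infty$. -/

import Mathlib

open MeasureTheory ProbabilityTheory

open scoped ENNReal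

noncomputable section

namespace UniformSeq

/-- The uniform law on the interval `[-1, 1]`. -/
def unif : Measure ℝ := volume[|Set.Icc (-1 : ℝ) 1]

instance : IsProbabilityMeasure unif :=
  cond_isProbabilityMeasure_of_finite (by simp) (by simp)

/-- The canonical space of the sequence `(U_k)`: here `U_k ω = ω k`. -/
abbrev Ω : Type := ℕ → ℝ

/-- The law on `Ω` under which the coordinates `U_k` are i.i.d. uniform on `[-1, 1]`. -/
def P : Measure Ω := Measure.infinitePi fun _ : ℕ => unif

instance : IsProbabilityMeasure P := by
  unfold P; infer_instance

/-- The block `[2⌊t/2⌋, 2⌊t/2⌋ + 2)` that contains `t ≥ 0`. -/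
def block (t : ℝ) : Set ℝ := Set.Ico (2 * (⌊t / 2⌋₊ : ℝ)) (2 * (⌊t / 2⌋₊ : ℝ) + 2)

/-- `Ψ_t`: the coordinate of index `⌊t/2⌋` is replaced by `t - 2⌊t/2⌋ - 1`. -/
def Psi (t : ℝ) (ω : Ω) : Ω :=
  Function.update ω ⌊t / 2⌋₊ (t - 2 * (⌊t / 2⌋₊ : ℝ) - 1)

/-- The finite difference operator
`∇_t X = X ∘ Ψ_t - (1/2) ∫_{block t} X ∘ Ψ_s ds`. -/
def nabla (t : ℝ) (X : Ω → ℝ) (ω : Ω) : ℝ :=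
  X (Psi t ω) - 1 / 2 * ∫ s in block t, X (Psi s ω)

/-- The domain of `∇`: the `X ∈ L²(Ω)` with `E ∫_0^∞ |∇_t X|² dt < ∞`. -/
def DomNabla : Set (Lp ℝ 2 P) :=
  {X | ∫⁻ ω, (∫⁻ t in Set.Ici (0 : ℝ), ‖nabla t X ω‖ₑ ^ 2) ∂P < ∞}

/-- `Δ_n`: the union of the boxes `∏ [2k_i, 2k_i + 2]` with pairwise distinct `k_1, …, k_n`. -/
def Delta (n : ℕ) : Set (Fin n → ℝ) :=
  ⋃ k : Fin n ↪ ℕ, Set.univ.pi fun i => Set.Icc (2 * (k i : ℝ)) (2 * (k i : ℝ) + 2)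

/-- The integrands of order `n` on which the multiple integral is given by a formula: symmetric
functions in `L¹ ∩ L²` vanishing outside `Δ_n` (in particular, for `n ≥ 1`, outside `ℝ₊ⁿ`). -/
structure IsKernel (n : ℕ) (f : (Fin n → ℝ) → ℝ) : Prop where
  symm : ∀ (σ : Equiv.Perm (Fin n)) (x : Fin n → ℝ), f (x ∘ σ) = f x
  zero_off : ∀ x, x ∉ Delta n → f x = 0
  integrable : Integrable f
  memLp : MemLp f 2

/-- The point `(2k_1 + 1 + U_{k_1}, …, 2k_r + 1 + U_{k_r}, y_1, …, y_{n-r})`. -/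
def mixedPoint {n r : ℕ} (ω : Ω) (k : Fin r → ℕ) (y : Fin (n - r) → ℝ) : Fin n → ℝ :=
  fun i => if h : (i : ℕ) < r then 2 * (k ⟨i, h⟩ : ℝ) + 1 + ω (k ⟨i, h⟩)
    else y ⟨i - r, by omega⟩

/-- The multiple stochastic integral `I_n(f)` of an integrand `f` as in `IsKernel`:
`∑_r (-1)^(n-r) / 2^(n-r) (n choose r) ∑_{k_1, …, k_r distinct} ∫ f(mixed point) dy`. -/
def multInt (n : ℕ) (f : (Fin n → ℝ) → ℝ) (ω : Ω) : ℝ :=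
  ∑ r ∈ Finset.range (n + 1), (-1 : ℝ) ^ (n - r) / 2 ^ (n - r) * (n.choose r : ℝ) *
    ∑' k : Fin r ↪ ℕ, ∫ y : Fin (n - r) → ℝ, f (mixedPoint ω k y)

/-- The `n`-th chaos `{I_n(f)}`, a closed subspace of `L²(Ω)`: since `I_n` is extended by
continuity to all square-integrable integrands, it is the closure of the space of
the integrals of the integrands in `L¹ ∩ L²`. -/
def chaos (n : ℕ) : Submodule ℝ (Lp ℝ 2 P) :=
  (Submodule.span ℝ
    {Z : Lp ℝ 2 P | ∃ f, IsKernel n f ∧ Z =ᵐ[P] multInt n f}).topologicalClosure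

instance (n : ℕ) : CompleteSpace (chaos n) := by
  unfold chaos; infer_instance

/-- The inverse of the Ornstein-Uhlenbeck operator on centered variables: if `X = ∑_{n ≥ 1} X_n`
with `X_n` in the `n`-th chaos, then `L⁻¹ X = -∑_{n ≥ 1} X_n / n` (convergence in `L²(Ω)`). The
component `X_n` is the orthogonal projection of `X` on the `n`-th chaos. -/
def Linv (X : Lp ℝ 2 P) : Lp ℝ 2 P :=
  -∑' n : ℕ, (1 / ((n : ℝ) + 1)) • (chaos (n + 1)).starProjection X

/-- The Wasserstein distance between two laws on `ℝ`, as the supremum of `|∫ h dμ - ∫ h dν|` over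
the functions `h` with Lipschitz constant at most `1`. -/
def dW (μ ν : Measure ℝ) : ℝ≥0∞ :=
  ⨆ (h : ℝ → ℝ) (_ : LipschitzWith 1 h), ‖∫ x, h x ∂μ - ∫ x, h x ∂ν‖ₑ

end UniformSeq

end

/-!
Stein's method reduces the bound to comparing `E[f'(X)]` with `E[X f(X)]`, where `f` solves Stein's
equation `f' - x f = g` with `g = h - ∫ h d𝒩` for a 1-Lipschitz `h`. As `u ↦ u + g u` is monotone
and the solution for it is `f - 1`, the signs of solutions with monotone right-hand sides bound `f`
and `(x f)'` by 1 in absolute value, so `f' = x f + g` is 2-Lipschitz.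

The Hoeffding decomposition splits `L²(Ω)` into the orthogonal spaces spanned by the products
`∏_{k ∈ S} g_k(U_k)` of centred functions of the coordinates in a finite set `S`. The multiple
integral of order `n` of a suitable tensor product is such a product with `|S| = n`, and every
multiple integral of order `n` is orthogonal to the products with `|S| ≠ n`; hence the `n`-th chaos
is the sum of the Hoeffding spaces with `|S| = n`. On the block of index `k`, the operator `∇` is
the projection `D_k` on the part that is centred in the coordinate `k`, which keeps exactly the
components with `k ∈ S`. Counting the `k ∈ S` gives `E[X Z] = -∑_k E[(D_k L⁻¹X) Z]` for all `Z`.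
For `Z = f(X)`, the Taylor expansion of `f` along the resampling of the coordinate `k` yields the
covariance `⟨∇X, -∇L⁻¹X⟩ / 2` and a remainder bounded by the last two terms.
-/

noncomputable section

namespace SteinEquation

open Real Set Filter Topology

local notation "γ" => gaussianReal 0 1

local notation "φ" => gaussianPDFReal 0 1

lemma pdf_pos (x : ℝ) : 0 < φ x := gaussianPDFReal_pos 0 1 x one_ne_zero

lemma pdf_neg (x : ℝ) : φ (-x) = φ x := by simp [gaussianPDFReal]

lemma hasDerivAt_pdf (x : ℝ) : HasDerivAt φ (-x * φ x) x := by
  rw [gaussianPDFReal_def]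
  have h : HasDerivAt (fun u : ℝ => -(u - 0) ^ 2 / (2 * ((1 : NNReal) : ℝ))) (-x) x := by
    refine ((((hasDerivAt_id' x).sub_const 0).fun_pow 2).fun_neg.div_const _).congr_deriv ?_
    norm_num
    ring
  exact (h.exp.const_mul _).congr_deriv (by ring)

lemma tendsto_pdf_atTop : Tendsto φ atTop (𝓝 0) := by
  have h : Tendsto (fun u : ℝ => exp (-(u ^ 2 / 2))) atTop (𝓝 0) :=
    tendsto_exp_neg_atTop_nhds_zero.comp
      ((tendsto_pow_atTop two_ne_zero).atTop_div_const two_pos)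
  simpa [gaussianPDFReal_def, neg_div] using h.const_mul (√(2 * π))⁻¹

lemma integrable_iff_integrable_pdf_mul {g : ℝ → ℝ} :
    Integrable g γ ↔ Integrable fun u => φ u * g u := by
  rw [gaussianReal_of_var_ne_zero _ one_ne_zero, integrable_withDensity_iff_integrable_smul'
    (measurable_gaussianPDF 0 1) (ae_of_all _ fun _ => gaussianPDF_lt_top)]
  simp only [toReal_gaussianPDF, smul_eq_mul]

lemma setIntegral_eq_setIntegral_pdf_mul {s : Set ℝ} (hs : MeasurableSet s) (g : ℝ → ℝ) :
    ∫ u in s, g u ∂γ = ∫ u in s, φ u * g u := by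
  rw [gaussianReal_of_var_ne_zero _ one_ne_zero, setIntegral_withDensity_eq_setIntegral_toReal_smul
    (measurable_gaussianPDF 0 1) (ae_of_all _ fun _ => gaussianPDF_lt_top) _ hs]
  simp only [toReal_gaussianPDF, smul_eq_mul]

lemma integrable_id : Integrable (fun x : ℝ => x) γ :=
  (memLp_id_gaussianReal (μ := 0) (v := 1) 1).integrable le_rfl

lemma hasDerivAt_setIntegral_Iic {g : ℝ → ℝ} (hg : Continuous g) (hi : Integrable g γ) (x : ℝ) :
    HasDerivAt (fun y => ∫ u in Iic y, g u ∂γ) (φ x * g x) x := by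
  have hc : Continuous fun u => φ u * g u :=
    (continuous_iff_continuousAt.2 fun u => (hasDerivAt_pdf u).continuousAt).mul hg
  have hi' := integrable_iff_integrable_pdf_mul.1 hi
  have h (y : ℝ) : ∫ u in Iic y, g u ∂γ =
      (∫ u in Iic (0 : ℝ), φ u * g u) + ∫ u in (0)..y, φ u * g u := by
    rw [setIntegral_eq_setIntegral_pdf_mul measurableSet_Iic,
      ← intervalIntegral.integral_Iic_sub_Iic hi'.integrableOn hi'.integrableOn]
    ring
  simp only [h]
  exact (hc.integral_hasStrictDerivAt 0 x).hasDerivAt.const_add _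

lemma setIntegral_Ioi_id (x : ℝ) : ∫ u in Ioi x, u ∂γ = φ x := by
  rw [setIntegral_eq_setIntegral_pdf_mul measurableSet_Ioi]
  have h := integral_Ioi_of_hasDerivAt_of_tendsto' (a := x) (f := fun u => -φ u)
    (f' := fun u => φ u * u) (m := 0)
    (fun u _ => (hasDerivAt_pdf u).fun_neg.congr_deriv (by ring))
    (integrable_iff_integrable_pdf_mul.1 integrable_id).integrableOn
    (by simpa using tendsto_pdf_atTop.neg)
  simpa using h

lemma setIntegral_Iic_comp_neg (g : ℝ → ℝ) (x : ℝ) :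
    ∫ u in Iic x, g (-u) ∂γ = ∫ u in Ioi (-x), g u ∂γ := by
  rw [setIntegral_eq_setIntegral_pdf_mul measurableSet_Iic,
    setIntegral_eq_setIntegral_pdf_mul measurableSet_Ioi, ← integral_comp_neg_Iic]
  simp only [pdf_neg]

lemma setIntegral_Iic_add_Ioi {g : ℝ → ℝ} (hi : Integrable g γ) (x : ℝ) :
    (∫ u in Iic x, g u ∂γ) + ∫ u in Ioi x, g u ∂γ = ∫ u, g u ∂γ := by
  rw [← compl_Iic, integral_add_compl measurableSet_Iic hi]

lemma real_Iic_eq_real_Ioi_neg (x : ℝ) : Measure.real γ (Iic x) = Measure.real γ (Ioi (-x)) := by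
  simpa using setIntegral_Iic_comp_neg (fun _ => 1) x

lemma real_Ioi_eq_one_sub (x : ℝ) : Measure.real γ (Ioi x) = 1 - Measure.real γ (Iic x) := by
  rw [← compl_Iic, probReal_compl_eq_one_sub measurableSet_Iic]

lemma hasDerivAt_real_Ioi (x : ℝ) :
    HasDerivAt (fun y => Measure.real γ (Ioi y)) (-φ x) x := by
  have h := (hasDerivAt_setIntegral_Iic continuous_const (integrable_const 1) x).const_sub 1
  simpa [real_Ioi_eq_one_sub] using h

lemma tendsto_real_Ioi_atTop : Tendsto (fun y => Measure.real γ (Ioi y)) atTop (𝓝 0) := by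
  simp only [real_Ioi_eq_one_sub, ← cdf_eq_real]
  simpa using (tendsto_cdf_atTop γ).const_sub 1

/-- The ratio of the tail to the density of the standard normal law. -/
def millsRatio (x : ℝ) : ℝ := Measure.real γ (Ioi x) / φ x

/-- Birnbaum's lower bound for `millsRatio`, the positive root `r` of `r ^ 2 + x * r = 1`. -/
def birnbaumRatio (x : ℝ) : ℝ := (√(x ^ 2 + 4) - x) / 2

lemma millsRatio_nonneg (x : ℝ) : 0 ≤ millsRatio x :=
  div_nonneg measureReal_nonneg (pdf_pos x).le

lemma birnbaumRatio_pos (x : ℝ) : 0 < birnbaumRatio x :=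
  half_pos (sub_pos.2 (lt_sqrt_of_sq_lt (by linarith)))

lemma birnbaumRatio_sq_add (x : ℝ) : birnbaumRatio x ^ 2 + x * birnbaumRatio x = 1 := by
  have h : √(x ^ 2 + 4) ^ 2 = x ^ 2 + 4 := sq_sqrt (by positivity)
  unfold birnbaumRatio
  linear_combination h / 4

lemma birnbaumRatio_le_one {x : ℝ} (hx : 0 ≤ x) : birnbaumRatio x ≤ 1 := by
  nlinarith [birnbaumRatio_sq_add x, birnbaumRatio_pos x]

lemma hasDerivAt_birnbaumRatio (x : ℝ) :
    HasDerivAt birnbaumRatio (-(birnbaumRatio x / √(x ^ 2 + 4))) x := by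
  have h : HasDerivAt (fun y : ℝ => y ^ 2 + 4) (2 * x) x := by
    simpa using (hasDerivAt_pow 2 x).add_const 4
  refine (((h.sqrt (by positivity)).fun_sub (hasDerivAt_id' x)).div_const 2).congr_deriv ?_
  have : √(x ^ 2 + 4) ≠ 0 := by positivity
  unfold birnbaumRatio
  field_simp
  ring

lemma birnbaumRatio_le_millsRatio (x : ℝ) : birnbaumRatio x ≤ millsRatio x := by
  rw [millsRatio, le_div_iff₀ (pdf_pos x), ← sub_nonneg]
  set d : ℝ → ℝ := fun y => Measure.real γ (Ioi y) - birnbaumRatio y * φ y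
  have hderiv (y : ℝ) := (hasDerivAt_real_Ioi y).sub
    ((hasDerivAt_birnbaumRatio y).mul (hasDerivAt_pdf y))
  have hanti : Antitone d := by
    refine antitone_of_hasDerivAt_nonpos hderiv fun y => ?_
    have hr := birnbaumRatio_pos y
    have hsq := birnbaumRatio_sq_add y
    have hs : √(y ^ 2 + 4) = 2 * birnbaumRatio y + y := by unfold birnbaumRatio; ring
    have hs0 : 0 < √(y ^ 2 + 4) := by positivity
    have hle : 1 / √(y ^ 2 + 4) ≤ birnbaumRatio y := by
      rw [div_le_iff₀ hs0, hs]
      nlinarith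
    calc _ = -(φ y * birnbaumRatio y * (birnbaumRatio y - 1 / √(y ^ 2 + 4))) := by
          linear_combination φ y * hsq
      _ ≤ 0 := neg_nonpos.2 <|
          mul_nonneg (mul_nonneg (pdf_pos y).le hr.le) (sub_nonneg.2 hle)
  have hlim : Tendsto d atTop (𝓝 0) := by
    have h : Tendsto (fun y => birnbaumRatio y * φ y) atTop (𝓝 0) := by
      refine squeeze_zero' (.of_forall fun y =>
        mul_nonneg (birnbaumRatio_pos y).le (pdf_pos y).le) ?_ tendsto_pdf_atTop
      filter_upwards [eventually_ge_atTop 0] with y hy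
      exact mul_le_of_le_one_left (pdf_pos y).le (birnbaumRatio_le_one hy)
    simpa using tendsto_real_Ioi_atTop.sub h
  exact hanti.le_of_tendsto hlim x

lemma le_one_add_sq_mul_millsRatio (x : ℝ) : x ≤ (1 + x ^ 2) * millsRatio x := by
  have hr := birnbaumRatio_pos x
  have hsq := birnbaumRatio_sq_add x
  have h : x * birnbaumRatio x ≤ (1 + x ^ 2) * birnbaumRatio x * birnbaumRatio x := by
    have e : (1 + x ^ 2) * birnbaumRatio x * birnbaumRatio x - x * birnbaumRatio x =
        birnbaumRatio x ^ 4 := by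
      linear_combination (x * birnbaumRatio x - birnbaumRatio x ^ 2 ) * hsq
    nlinarith [pow_pos hr 4]
  calc x ≤ (1 + x ^ 2) * birnbaumRatio x := le_of_mul_le_mul_right h hr
    _ ≤ (1 + x ^ 2) * millsRatio x := by gcongr; exact birnbaumRatio_le_millsRatio x

lemma one_sub_mul_millsRatio_le {x : ℝ} (hx : 0 ≤ x) :
    1 - x * millsRatio x ≤ birnbaumRatio x ^ 2 := by
  nlinarith [birnbaumRatio_sq_add x, birnbaumRatio_le_millsRatio x]

lemma sqrt_add_mul_birnbaumRatio_sq_le_one {x : ℝ} (hx : 0 ≤ x) :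
    (√(x ^ 2 + 1) + x) * birnbaumRatio x ^ 2 ≤ 1 := by
  have hr := birnbaumRatio_pos x
  have hr1 := birnbaumRatio_le_one hx
  have hsq := birnbaumRatio_sq_add x
  set r := birnbaumRatio x
  have hxr : x * r = 1 - r ^ 2 := by linear_combination hsq
  have h0 : 0 ≤ 1 - x * r ^ 2 := by nlinarith
  have hle : (√(x ^ 2 + 1) * r ^ 2) ^ 2 ≤ (1 - x * r ^ 2) ^ 2 := by
    have e : (1 - x * r ^ 2) ^ 2 - (√(x ^ 2 + 1) * r ^ 2) ^ 2 = (1 - r) ^ 3 * (1 + r) := by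
      rw [mul_pow, sq_sqrt (by positivity)]
      linear_combination (-2 * r) * hxr
    rw [← sub_nonneg, e]
    exact mul_nonneg (pow_nonneg (sub_nonneg.2 hr1) 3) (by linarith)
  linarith [(abs_le_of_sq_le_sq' hle h0).2]

/-- The solution of Stein's equation `f' - x f = g`, for a function `g` that is centered under the
standard normal law. -/
def solution (g : ℝ → ℝ) (x : ℝ) : ℝ := (∫ u in Iic x, g u ∂γ) / φ x

section

variable {g : ℝ → ℝ}

lemma hasDerivAt_solution (hg : Continuous g) (hi : Integrable g γ) (x : ℝ) :
    HasDerivAt (solution g) (x * solution g x + g x) x := by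
  have hx := (pdf_pos x).ne'
  refine ((hasDerivAt_setIntegral_Iic hg hi x).div (hasDerivAt_pdf x) hx).congr_deriv ?_
  unfold solution
  field_simp
  ring

lemma solution_eq_neg_setIntegral_Ioi (hi : Integrable g γ) (h0 : ∫ u, g u ∂γ = 0) (x : ℝ) :
    solution g x = -((∫ u in Ioi x, g u ∂γ) / φ x) := by
  rw [solution, ← neg_div, eq_neg_of_add_eq_zero_left ((setIntegral_Iic_add_Ioi hi x).trans h0)]

lemma solution_id (x : ℝ) : solution (fun u => u) x = -1 := by
  rw [solution_eq_neg_setIntegral_Ioi integrable_id integral_id_gaussianReal, setIntegral_Ioi_id,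
    div_self (pdf_pos x).ne']

lemma solution_neg (x : ℝ) : solution (fun u => -g u) x = -solution g x := by
  simp [solution, integral_neg, neg_div]

lemma solution_id_add (hi : Integrable g γ) (x : ℝ) :
    solution (fun u => u + g u) x = -1 + solution g x := by
  rw [← solution_id x, solution, integral_add integrable_id.integrableOn hi.integrableOn, add_div]
  rfl

lemma solution_comp_neg (hi : Integrable g γ) (h0 : ∫ u, g u ∂γ = 0) (x : ℝ) :
    solution (fun u => g (-u)) x = -solution g (-x) := by
  rw [solution_eq_neg_setIntegral_Ioi hi h0, neg_neg, solution, setIntegral_Iic_comp_neg, pdf_neg]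

lemma solution_le_mul_millsRatio_neg (hi : Integrable g γ) (hm : Monotone g) (x : ℝ) :
    solution g x ≤ g x * millsRatio (-x) := by
  have h : ∫ u in Iic x, g u ∂γ ≤ ∫ _ in Iic x, g x ∂γ :=
    setIntegral_mono_on hi.integrableOn (integrable_const _).integrableOn measurableSet_Iic
      fun u hu => hm hu
  rw [setIntegral_const, smul_eq_mul, real_Iic_eq_real_Ioi_neg] at h
  calc solution g x ≤ Measure.real γ (Ioi (-x)) * g x / φ x := by
        have := pdf_pos x
        unfold solution
        gcongr
    _ = g x * millsRatio (-x) := by rw [millsRatio, pdf_neg]; ring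

lemma solution_le_neg_mul_millsRatio (hi : Integrable g γ) (h0 : ∫ u, g u ∂γ = 0)
    (hm : Monotone g) (x : ℝ) : solution g x ≤ -(g x * millsRatio x) := by
  have h : ∫ _ in Ioi x, g x ∂γ ≤ ∫ u in Ioi x, g u ∂γ :=
    setIntegral_mono_on (integrable_const _).integrableOn hi.integrableOn measurableSet_Ioi
      fun u hu => hm (le_of_lt hu)
  rw [setIntegral_const, smul_eq_mul] at h
  calc solution g x ≤ -(Measure.real γ (Ioi x) * g x / φ x) := by
        have := pdf_pos x
        rw [solution_eq_neg_setIntegral_Ioi hi h0]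
        gcongr
    _ = -(g x * millsRatio x) := by rw [millsRatio]; ring

lemma solution_nonpos_of_monotone (hi : Integrable g γ) (h0 : ∫ u, g u ∂γ = 0) (hm : Monotone g)
    (x : ℝ) : solution g x ≤ 0 := by
  rcases le_total (g x) 0 with h | h
  · exact (solution_le_mul_millsRatio_neg hi hm x).trans
      (mul_nonpos_of_nonpos_of_nonneg h (millsRatio_nonneg _))
  · exact (solution_le_neg_mul_millsRatio hi h0 hm x).trans
      (neg_nonpos.2 (mul_nonneg h (millsRatio_nonneg _)))

lemma deriv_mul_solution_nonpos_of_monotone (hi : Integrable g γ) (h0 : ∫ u, g u ∂γ = 0)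
    (hm : Monotone g) (x : ℝ) : solution g x + x * (x * solution g x + g x) ≤ 0 := by
  have hx : 0 ≤ 1 + x ^ 2 := by positivity
  rcases le_total (g x) 0 with h | h
  · have h1 := mul_le_mul_of_nonneg_left (solution_le_mul_millsRatio_neg hi hm x) hx
    have h2 := mul_le_mul_of_nonpos_left (le_one_add_sq_mul_millsRatio (-x)) h
    rw [neg_sq] at h2
    linarith
  · have h1 := mul_le_mul_of_nonneg_left (solution_le_neg_mul_millsRatio hi h0 hm x) hx
    have h2 := mul_le_mul_of_nonneg_left (le_one_add_sq_mul_millsRatio x) h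
    linarith

lemma monotone_id_add_of_lipschitzWith (hl : LipschitzWith 1 g) :
    Monotone fun u => u + g u := by
  intro a b hab
  have h := hl.dist_le_mul a b
  rw [Real.dist_eq, Real.dist_eq, abs_sub_comm a, abs_of_nonneg (sub_nonneg.2 hab),
    NNReal.coe_one, one_mul] at h
  linarith [(abs_le.1 h).2]

/-- As `u ↦ u + g u` is monotone and its solution is `-1 + solution g`, the signs of
the solutions of monotone right-hand sides become bounds for `solution g`. -/
lemma solution_le_one_and_deriv_mul_le_one (hi : Integrable g γ) (h0 : ∫ u, g u ∂γ = 0)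
    (hl : LipschitzWith 1 g) (x : ℝ) :
    solution g x ≤ 1 ∧ solution g x + x * (x * solution g x + g x) ≤ 1 := by
  have h0' : ∫ u, u + g u ∂γ = 0 := by
    rw [integral_add integrable_id hi, integral_id_gaussianReal, h0, add_zero]
  have hm := monotone_id_add_of_lipschitzWith hl
  have hi' : Integrable (fun u => u + g u) γ := integrable_id.add hi
  have h1 := solution_nonpos_of_monotone hi' h0' hm x
  have h2 := deriv_mul_solution_nonpos_of_monotone hi' h0' hm x
  rw [solution_id_add hi] at h1 h2
  constructor <;> linarith

lemma abs_solution_le_one_and_abs_deriv_mul_le_one (hi : Integrable g γ) (h0 : ∫ u, g u ∂γ = 0)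
    (hl : LipschitzWith 1 g) (x : ℝ) :
    |solution g x| ≤ 1 ∧ |solution g x + x * (x * solution g x + g x)| ≤ 1 := by
  have h1 := solution_le_one_and_deriv_mul_le_one hi h0 hl x
  have h2 := solution_le_one_and_deriv_mul_le_one hi.neg
    (by simp only [Pi.neg_apply, integral_neg, h0, neg_zero]) hl.neg x
  simp only [Pi.neg_apply, Pi.neg_def, solution_neg] at h2
  constructor <;> rw [abs_le] <;> constructor <;> linarith

lemma lipschitzWith_deriv_solution (hi : Integrable g γ) (h0 : ∫ u, g u ∂γ = 0)
    (hl : LipschitzWith 1 g) : LipschitzWith 2 fun x => x * solution g x + g x := by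
  have hd (x : ℝ) : HasDerivAt (fun x => x * solution g x)
      (solution g x + x * (x * solution g x + g x)) x := by
    simpa using (hasDerivAt_id' x).fun_mul (hasDerivAt_solution hl.continuous hi x)
  have h : LipschitzWith 1 fun x => x * solution g x := by
    rw [← lipschitzOnWith_univ]
    refine convex_univ.lipschitzOnWith_of_nnnorm_hasDerivWithin_le
      (fun x _ => (hd x).hasDerivWithinAt) fun x _ => ?_
    exact (abs_solution_le_one_and_abs_deriv_mul_le_one hi h0 hl x).2
  exact one_add_one_eq_two (R := NNReal) ▸ h.add hl

lemma abs_setIntegral_Ioi_sub_le (hi : Integrable g γ) (hl : LipschitzWith 1 g) (x : ℝ) :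
    |∫ u in Ioi x, (g u - g x) ∂γ| ≤ φ x - x * Measure.real γ (Ioi x) := by
  calc |∫ u in Ioi x, (g u - g x) ∂γ| ≤ ∫ u in Ioi x, |g u - g x| ∂γ :=
        abs_integral_le_integral_abs
    _ ≤ ∫ u in Ioi x, (u - x) ∂γ := by
        refine setIntegral_mono_on (hi.sub (integrable_const _)).abs.integrableOn
          (integrable_id.sub (integrable_const _)).integrableOn measurableSet_Ioi fun u hu => ?_
        simpa [Real.dist_eq, abs_of_pos (sub_pos.2 (mem_Ioi.1 hu))] using hl.dist_le_mul u x
    _ = φ x - x * Measure.real γ (Ioi x) := by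
        rw [integral_sub integrable_id.integrableOn (integrable_const _).integrableOn,
          setIntegral_Ioi_id, setIntegral_const, smul_eq_mul, mul_comm]

lemma abs_deriv_solution_le_one_of_nonneg (hi : Integrable g γ) (h0 : ∫ u, g u ∂γ = 0)
    (hl : LipschitzWith 1 g) (hg : ∀ x, |g x| ≤ √(x ^ 2 + 1)) {x : ℝ} (hx : 0 ≤ x) :
    |x * solution g x + g x| ≤ 1 := by
  set D := (∫ u in Ioi x, (g u - g x) ∂γ) / φ x
  set q := 1 - x * millsRatio x with hq
  have hφ := pdf_pos x
  have hD : |D| ≤ q := by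
    rw [abs_div, abs_of_pos hφ, div_le_iff₀ hφ]
    refine (abs_setIntegral_Ioi_sub_le hi hl x).trans_eq ?_
    rw [hq, millsRatio]
    field_simp
  have hsol : x * solution g x + g x = g x * q - x * D := by
    rw [solution_eq_neg_setIntegral_Ioi hi h0, hq, millsRatio]
    simp only [D]
    rw [integral_sub hi.integrableOn (integrable_const _).integrableOn, setIntegral_const,
      smul_eq_mul]
    field_simp
    ring
  calc |x * solution g x + g x| ≤ |g x * q| + |x * D| := hsol ▸ abs_sub _ _
    _ = |g x| * q + x * |D| := by
        rw [abs_mul, abs_mul, abs_of_nonneg ((abs_nonneg D).trans hD), abs_of_nonneg hx]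
    _ ≤ √(x ^ 2 + 1) * q + x * q := by
        have := (abs_nonneg D).trans hD
        gcongr
        exact hg x
    _ = (√(x ^ 2 + 1) + x) * q := by ring
    _ ≤ (√(x ^ 2 + 1) + x) * birnbaumRatio x ^ 2 := by
        gcongr
        exact one_sub_mul_millsRatio_le hx
    _ ≤ 1 := sqrt_add_mul_birnbaumRatio_sq_le_one hx

lemma abs_deriv_solution_le_one (hi : Integrable g γ) (h0 : ∫ u, g u ∂γ = 0)
    (hl : LipschitzWith 1 g) (hg : ∀ x, |g x| ≤ √(x ^ 2 + 1)) (x : ℝ) :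
    |x * solution g x + g x| ≤ 1 := by
  rcases le_total 0 x with hx | hx
  · exact abs_deriv_solution_le_one_of_nonneg hi h0 hl hg hx
  · have hsymm := gaussianReal_map_neg (μ := 0) (v := 1)
    rw [neg_zero] at hsymm
    have hi' : Integrable (fun u => g (-u)) γ := by
      rw [← hsymm] at hi
      exact hi.comp_measurable measurable_neg
    have h0' : ∫ u, g (-u) ∂γ = 0 := by
      rw [← hsymm, integral_map measurable_neg.aemeasurable
        hl.continuous.aestronglyMeasurable] at h0
      exact h0
    have hl' : LipschitzWith 1 fun u => g (-u) := by
      refine LipschitzWith.of_dist_le_mul fun a b => ?_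
      simpa using hl.dist_le_mul (-a) (-b)
    have h := abs_deriv_solution_le_one_of_nonneg hi' h0' hl' (fun x => by simpa using hg (-x))
      (neg_nonneg.2 hx)
    rw [solution_comp_neg hi h0] at h
    simpa using h

end

lemma abs_sub_sub_le_of_lipschitzWith_deriv {f f' : ℝ → ℝ} {K : NNReal}
    (hf : ∀ x, HasDerivAt f (f' x) x) (hl : LipschitzWith K f') (x y : ℝ) :
    |f y - f x - f' x * (y - x)| ≤ K / 2 * (y - x) ^ 2 := by
  set F : ℝ → ℝ := fun t => f (x + t * (y - x)) - f x - f' x * (t * (y - x))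
  have hline (t : ℝ) : HasDerivAt (fun t : ℝ => t * (y - x)) (y - x) t := by
    simpa using (hasDerivAt_id' t).mul_const (y - x)
  have hF (t : ℝ) : HasDerivAt F ((f' (x + t * (y - x)) - f' x) * (y - x)) t :=
    ((((hf _).comp t ((hline t).const_add x)).sub_const (f x)).fun_sub
      ((hline t).const_mul (f' x))).congr_deriv (by ring)
  have hB (t : ℝ) : HasDerivAt (fun t : ℝ => K / 2 * (y - x) ^ 2 * t ^ 2)
      (K * (y - x) ^ 2 * t) t :=
    ((hasDerivAt_pow 2 t).const_mul _).congr_deriv (by simp; ring)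
  have hbound (t : ℝ) (ht : t ∈ Ico (0 : ℝ) 1) :
      ‖(f' (x + t * (y - x)) - f' x) * (y - x)‖ ≤ K * (y - x) ^ 2 * t := by
    have h := hl.dist_le_mul (x + t * (y - x)) x
    rw [Real.dist_eq, Real.dist_eq, add_sub_cancel_left, abs_mul, abs_of_nonneg ht.1] at h
    rw [norm_mul, Real.norm_eq_abs, Real.norm_eq_abs]
    calc _ ≤ K * (t * |y - x|) * |y - x| := by gcongr
      _ = K * (y - x) ^ 2 * t := by rw [← sq_abs (y - x)]; ring
  have h := image_norm_le_of_norm_deriv_right_le_deriv_boundary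
    (fun t _ => (hF t).continuousAt.continuousWithinAt) (fun t _ => (hF t).hasDerivWithinAt)
    (by simp [F]) hB hbound (right_mem_Icc.2 zero_le_one)
  simpa [F] using h

lemma integrable_of_lipschitzWith {K : NNReal} {h : ℝ → ℝ} (hh : LipschitzWith K h) :
    Integrable h γ := by
  refine Integrable.mono' ((integrable_const |h 0|).add (integrable_id.abs.const_mul (K : ℝ)))
    hh.continuous.aestronglyMeasurable (ae_of_all _ fun u => ?_)
  have h1 := hh.dist_le_mul u 0
  rw [Real.dist_eq, Real.dist_eq, sub_zero] at h1
  simp only [Real.norm_eq_abs, Pi.add_apply]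
  linarith [abs_sub_abs_le_abs_sub (h u) (h 0)]

lemma integral_abs_sub_le (x : ℝ) : ∫ y, |x - y| ∂γ ≤ √(x ^ 2 + 1) := by
  have hL : MemLp (fun y => x - y) 2 γ := (memLp_const x).sub (memLp_id_gaussianReal 2)
  have hsq : ∫ y, (x - y) ^ 2 ∂γ = x ^ 2 + 1 := by
    have h1 := variance_eq_sub hL
    have h2 : Var[fun y => x - y; γ] = 1 := by
      rw [variance_const_sub (X := fun y => y) aestronglyMeasurable_id,
        variance_fun_id_gaussianReal, NNReal.coe_one]
    have h3 : ∫ y, x - y ∂γ = x := by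
      rw [integral_sub (integrable_const x) integrable_id, integral_id_gaussianReal]
      simp
    rw [h2, h3] at h1
    simp only [Pi.pow_apply] at h1
    linarith
  refine le_sqrt_of_sq_le ?_
  have h := variance_nonneg |fun y => x - y| γ
  rw [variance_eq_sub hL.abs] at h
  simp only [Pi.pow_apply, Pi.abs_apply, sq_abs, hsq] at h
  linarith

lemma abs_sub_integral_le {h : ℝ → ℝ} (hh : LipschitzWith 1 h) (x : ℝ) :
    |h x - ∫ y, h y ∂γ| ≤ √(x ^ 2 + 1) := by
  have hi := integrable_of_lipschitzWith hh
  calc |h x - ∫ y, h y ∂γ| = |∫ y, (h x - h y) ∂γ| := by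
        rw [integral_sub (integrable_const _) hi]
        simp
    _ ≤ ∫ y, |h x - h y| ∂γ := abs_integral_le_integral_abs
    _ ≤ ∫ y, |x - y| ∂γ := by
        refine integral_mono ((integrable_const _).sub hi).abs
          ((integrable_const _).sub integrable_id).abs fun y => ?_
        simpa [Real.dist_eq] using hh.dist_le_mul x y
    _ ≤ √(x ^ 2 + 1) := integral_abs_sub_le x

/-- `f`, with derivative `f'`, is a solution of Stein's equation for `h`, with the bounds that are
available when `h` is `1`-Lipschitz. -/
structure IsBoundedSolution (h f f' : ℝ → ℝ) : Prop where
  hasDerivAt (x : ℝ) : HasDerivAt f (f' x) x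
  deriv_sub_mul (x : ℝ) : f' x - x * f x = h x - ∫ y, h y ∂γ
  abs_le_one (x : ℝ) : |f x| ≤ 1
  abs_deriv_le_one (x : ℝ) : |f' x| ≤ 1
  lipschitzWith_deriv : LipschitzWith 2 f'

theorem exists_isBoundedSolution {h : ℝ → ℝ} (hh : LipschitzWith 1 h) :
    ∃ f f' : ℝ → ℝ, IsBoundedSolution h f f' := by
  have hhi := integrable_of_lipschitzWith hh
  set g : ℝ → ℝ := fun x => h x - ∫ y, h y ∂γ
  have hl : LipschitzWith 1 g := by simpa [g] using hh.sub (LipschitzWith.const (∫ y, h y ∂γ))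
  have hi : Integrable g γ := hhi.sub (integrable_const _)
  have h0 : ∫ u, g u ∂γ = 0 := by simp [g, integral_sub hhi (integrable_const _)]
  exact ⟨solution g, fun x => x * solution g x + g x, {
    hasDerivAt := hasDerivAt_solution hl.continuous hi
    deriv_sub_mul := fun x => by simp [g]
    abs_le_one := fun x => (abs_solution_le_one_and_abs_deriv_mul_le_one hi h0 hl x).1
    abs_deriv_le_one := abs_deriv_solution_le_one hi h0 hl (abs_sub_integral_le hh)
    lipschitzWith_deriv := lipschitzWith_deriv_solution hi h0 hl }⟩

namespace IsBoundedSolution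

variable {h f f' : ℝ → ℝ}

lemma continuous (hs : IsBoundedSolution h f f') : Continuous f :=
  continuous_iff_continuousAt.2 fun y => (hs.hasDerivAt y).continuousAt

lemma abs_sub_sub_le_sq (hs : IsBoundedSolution h f f') (x y : ℝ) :
    |f y - f x - f' x * (y - x)| ≤ (y - x) ^ 2 := by
  simpa using abs_sub_sub_le_of_lipschitzWith_deriv hs.hasDerivAt hs.lipschitzWith_deriv x y

lemma integral_map_sub_integral_gaussianReal (hs : IsBoundedSolution h f f') {Ω : Type*}
    [MeasurableSpace Ω] {P : Measure Ω} [IsProbabilityMeasure P] {X : Ω → ℝ} (hX : Integrable X P) :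
    ∫ y, h y ∂(P.map X) - ∫ y, h y ∂γ = ∫ ω, f' (X ω) ∂P - ∫ ω, X ω * f (X ω) ∂P := by
  have hf'X : Integrable (fun ω => f' (X ω)) P := .of_bound
    (hs.lipschitzWith_deriv.continuous.comp_aestronglyMeasurable hX.aestronglyMeasurable) 1
    (ae_of_all _ fun ω => hs.abs_deriv_le_one _)
  have hXfX : Integrable (fun ω => X ω * f (X ω)) P := hX.mul_bdd (c := 1)
    (hs.continuous.comp_aestronglyMeasurable hX.aestronglyMeasurable)
    (ae_of_all _ fun ω => hs.abs_le_one _)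
  have h_eq : h = fun y => f' y - y * f y + ∫ y, h y ∂γ := funext fun y => by
    rw [hs.deriv_sub_mul, sub_add_cancel]
  have hh : Continuous h := by
    rw [h_eq]
    exact (hs.lipschitzWith_deriv.continuous.sub (continuous_id.mul hs.continuous)).add_const _
  have hhX : ∀ ω, h (X ω) = f' (X ω) - X ω * f (X ω) + ∫ y, h y ∂γ := fun ω => congrFun h_eq _
  rw [integral_map hX.aemeasurable hh.aestronglyMeasurable, ← integral_sub hf'X hXfX]
  simp_rw [hhX]
  have hsub : Integrable (fun ω => f' (X ω) - X ω * f (X ω)) P := hf'X.sub hXfX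
  rw [integral_add hsub (integrable_const _)]
  simp

end IsBoundedSolution

end SteinEquation

namespace HoeffdingDecomposition

open Function (update)
open scoped InnerProductSpace

section ResamplingInvariant

variable {ι : Type*} [DecidableEq ι] {α : ι → Type*} [∀ i, MeasurableSpace (α i)]

/-- A law `P` on a product space is resampling invariant if redrawing any one coordinate `k` from
`μ k`, independently of all coordinates, does not change it. The motivating example is the product
of the `μ k`; the class also covers laws that are such a product only up to unfolding. -/
class ResamplingInvariant (P : Measure (∀ i, α i)) (μ : ∀ i, Measure (α i)) : Prop where
  measurePreserving_update (k : ι) : MeasurePreserving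
    (fun p : (∀ i, α i) × α k => update p.1 k p.2) (P.prod (μ k)) P

open ResamplingInvariant (measurePreserving_update)

variable {P : Measure (∀ i, α i)} (μ : ∀ i, Measure (α i))

instance [∀ i, IsProbabilityMeasure (μ i)] : ResamplingInvariant (Measure.infinitePi μ) μ where
  measurePreserving_update k := by
    refine ⟨measurable_update', Measure.eq_infinitePi _ fun s t ht => ?_⟩
    rw [Measure.map_apply measurable_update' (.pi s.countable_toSet fun i _ => ht i)]
    have preimage_eq : (fun p : (∀ i, α i) × α k => update p.1 k p.2) ⁻¹' (s : Set ι).pi t =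
        ((s.erase k : Finset ι) : Set ι).pi t ×ˢ if k ∈ s then t k else Set.univ := by
      ext ⟨ω, u⟩
      rw [Set.mem_preimage, Set.update_mem_pi_iff]
      split_ifs with hk <;> simp [hk]
    rw [preimage_eq, Measure.prod_prod, Measure.infinitePi_pi _ fun i _ => ht i]
    split_ifs with hk
    · exact Finset.prod_erase_mul _ _ hk
    · rw [measure_univ, mul_one, Finset.erase_eq_of_notMem hk]

section Resample

variable [ResamplingInvariant P μ]

lemma integrable_comp_update {E : Type*} [NormedAddCommGroup E] (k : ι) {F : (∀ i, α i) → E}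
    (hF : Integrable F P) :
    Integrable (fun p : (∀ i, α i) × α k => F (update p.1 k p.2)) (P.prod (μ k)) :=
  (measurePreserving_update k).integrable_comp_of_integrable hF

variable [∀ i, IsProbabilityMeasure (μ i)]

lemma lintegral_lintegral_update (k : ι) {F : (∀ i, α i) → ℝ≥0∞} (hF : Measurable F) :
    ∫⁻ ω, (∫⁻ u, F (update ω k u) ∂μ k) ∂P = ∫⁻ ω, F ω ∂P := by
  rw [← (measurePreserving_update (μ := μ) k).lintegral_comp hF, lintegral_prod]
  exact (hF.comp measurable_update').aemeasurable

variable [SFinite P]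

lemma integral_integral_update {E : Type*} [NormedAddCommGroup E] [NormedSpace ℝ E] (k : ι)
    {F : (∀ i, α i) → E} (hF : Integrable F P) :
    ∫ ω, (∫ u, F (update ω k u) ∂μ k) ∂P = ∫ ω, F ω ∂P := by
  have hmap := (measurePreserving_update (P := P) (μ := μ) k).map_eq
  rw [← integral_prod _ (integrable_comp_update μ k hF)]
  conv_rhs => rw [← hmap]
  exact (integral_map measurable_update'.aemeasurable
    (by rw [hmap]; exact hF.aestronglyMeasurable)).symm

lemma ae_memLp_two_update (k : ι) {x : (∀ i, α i) → ℝ} (hx : MemLp x 2 P) :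
    ∀ᵐ ω ∂P, MemLp (fun u => x (update ω k u)) 2 (μ k) := by
  have hx' := hx.comp_measurePreserving (measurePreserving_update (μ := μ) k)
  filter_upwards [hx'.aestronglyMeasurable.prodMk_left, hx'.integrable_sq.prod_right_ae]
    with ω hm hi using (memLp_two_iff_integrable_sq hm).2 hi

end Resample

/-! ### Averaging and centring in one coordinate -/

section CoordDiff

/-- The conditional expectation of `x` given all coordinates but the `k`-th. -/
def coordAvg (k : ι) (x : (∀ i, α i) → ℝ) (ω : ∀ i, α i) : ℝ :=
  ∫ u, x (update ω k u) ∂μ k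

/-- The part of `x` that is centred in the coordinate `k`. -/
def coordDiff (k : ι) (x : (∀ i, α i) → ℝ) (ω : ∀ i, α i) : ℝ :=
  x ω - coordAvg μ k x ω

lemma coordAvg_update (k : ι) (x : (∀ i, α i) → ℝ) (ω : ∀ i, α i) (v : α k) :
    coordAvg μ k x (update ω k v) = coordAvg μ k x ω := by
  simp only [coordAvg, Function.update_idem]

lemma coordDiff_update (k : ι) (x : (∀ i, α i) → ℝ) (ω : ∀ i, α i) (v : α k) :
    coordDiff μ k x (update ω k v) = x (update ω k v) - coordAvg μ k x ω := by
  rw [coordDiff, coordAvg_update]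

variable [∀ i, IsProbabilityMeasure (μ i)]

lemma measurable_coordDiff (k : ι) {x : (∀ i, α i) → ℝ} (hx : Measurable x) :
    Measurable (coordDiff μ k x) :=
  hx.sub (hx.comp measurable_update').stronglyMeasurable.integral_prod_right'.measurable

variable [SFinite P] [ResamplingInvariant P μ]

lemma memLp_two_coordAvg (k : ι) {x : (∀ i, α i) → ℝ} (hx : MemLp x 2 P) :
    MemLp (coordAvg μ k x) 2 P := by
  have hx' := hx.comp_measurePreserving (measurePreserving_update (μ := μ) k)
  have hm : AEStronglyMeasurable (coordAvg μ k x) P :=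
    hx'.aestronglyMeasurable.integral_prod_right'
  rw [memLp_two_iff_integrable_sq hm]
  refine hx'.integrable_sq.integral_prod_left.mono' (hm.pow 2) ?_
  filter_upwards [ae_memLp_two_update μ k hx] with ω hω
  have hvar := variance_nonneg (fun u => x (update ω k u)) (μ k)
  rw [variance_eq_sub hω, sub_nonneg] at hvar
  rw [Real.norm_of_nonneg (sq_nonneg _)]
  exact hvar

lemma memLp_two_coordDiff (k : ι) {x : (∀ i, α i) → ℝ} (hx : MemLp x 2 P) :
    MemLp (coordDiff μ k x) 2 P := hx.sub (memLp_two_coordAvg μ k hx)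

lemma ae_memLp_two_coordDiff_update (k : ι) {x : (∀ i, α i) → ℝ} (hx : MemLp x 2 P) :
    ∀ᵐ ω ∂P, MemLp (fun u => coordDiff μ k x (update ω k u)) 2 (μ k) := by
  filter_upwards [ae_memLp_two_update μ k hx] with ω hω
  simp only [coordDiff_update]
  exact hω.sub (memLp_const _)

lemma ae_integral_coordDiff_update (k : ι) {x : (∀ i, α i) → ℝ} (hx : MemLp x 2 P) :
    ∀ᵐ ω ∂P, ∫ u, coordDiff μ k x (update ω k u) ∂μ k = 0 := by
  filter_upwards [ae_memLp_two_update μ k hx] with ω hω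
  simp only [coordDiff_update]
  rw [integral_sub (hω.integrable one_le_two) (integrable_const _)]
  simp [coordAvg]

end CoordDiff

end ResamplingInvariant

/-! ### Projections on a total orthogonal family -/

section OrthogonalFamily

variable {E ι : Type*} [NormedAddCommGroup E] [InnerProductSpace ℝ E]

lemma mem_orthogonal_topologicalClosure_span {s : Set E} {y : E} :
    y ∈ (Submodule.span ℝ s).topologicalClosureᗮ ↔ ∀ u ∈ s, ⟪u, y⟫_ℝ = 0 := by
  rw [Submodule.orthogonal_closure, ← Submodule.span_singleton_le_iff_mem,
    ← Submodule.isOrtho_iff_le, Submodule.isOrtho_comm, Submodule.isOrtho_span]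
  simp

lemma isOrtho_topologicalClosure_span {s t : Set E} (h : ∀ u ∈ s, ∀ v ∈ t, ⟪u, v⟫_ℝ = 0) :
    (Submodule.span ℝ s).topologicalClosure ⟂ (Submodule.span ℝ t).topologicalClosure := by
  rw [Submodule.isOrtho_iff_le]
  refine Submodule.topologicalClosure_minimal _ ?_ (Submodule.isClosed_orthogonal _)
  rw [Submodule.orthogonal_closure, ← Submodule.isOrtho_iff_le]
  exact Submodule.isOrtho_span.2 fun u hu v hv => h u hu v hv

lemma inner_starProjection_eq_inner_starProjection (K : Submodule ℝ E) [CompleteSpace K]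
    (y z : E) : ⟪K.starProjection y, z⟫_ℝ = ⟪K.starProjection y, K.starProjection z⟫_ℝ := by
  rw [← Submodule.inner_starProjection_left_eq_right,
    Submodule.starProjection_eq_self_iff.2 (Submodule.starProjection_apply_mem K y)]

variable {F : ι → Submodule ℝ E} [∀ i, CompleteSpace (F i)]

lemma summable_sq_norm_starProjection (ho : Pairwise (F · ⟂ F ·)) (y : E) :
    Summable fun i => ‖(F i).starProjection y‖ ^ 2 := by
  have hof : OrthogonalFamily ℝ (fun i => F i) fun i => (F i).subtypeₗᵢ :=
    OrthogonalFamily.of_pairwise fun i j hij => ho hij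
  refine summable_of_sum_le (c := ‖y‖ ^ 2) (fun i => sq_nonneg _) fun s => ?_
  set z := ∑ i ∈ s, (F i).starProjection y
  have norm_sq_eq : ‖z‖ ^ 2 = ∑ i ∈ s, ‖(F i).starProjection y‖ ^ 2 :=
    hof.norm_sum (fun i => ⟨_, Submodule.starProjection_apply_mem (F i) y⟩) s
  have inner_eq : ⟪z, y⟫_ℝ = ‖z‖ ^ 2 := by
    simp only [z, sum_inner, norm_sq_eq, inner_starProjection_eq_inner_starProjection,
      real_inner_self_eq_norm_sq]
  have hzy : ‖z‖ * ‖z‖ ≤ ‖z‖ * ‖y‖ := by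
    rw [← sq, ← inner_eq]
    exact real_inner_le_norm z y
  rw [← norm_sq_eq]
  nlinarith [sq_nonneg (‖y‖ - ‖z‖)]

variable [CompleteSpace E]

lemma summable_smul_starProjection (ho : Pairwise (F · ⟂ F ·)) {c : ι → ℝ} {C : ℝ}
    (hc : ∀ i, |c i| ≤ C) (y : E) : Summable fun i => c i • (F i).starProjection y := by
  have hof : OrthogonalFamily ℝ (fun i => F i) fun i => (F i).subtypeₗᵢ :=
    OrthogonalFamily.of_pairwise fun i j hij => ho hij
  set v : ∀ i, F i := fun i => ⟨_, Submodule.starProjection_apply_mem (F i) y⟩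
  refine (hof.summable_iff_norm_sq_summable fun i => c i • v i).2 ?_
  refine .of_nonneg_of_le (fun i => sq_nonneg _) (fun i => ?_)
    ((summable_sq_norm_starProjection ho y).mul_left (C ^ 2))
  rw [norm_smul, mul_pow]
  exact mul_le_mul_of_nonneg_right (pow_le_pow_left₀ (abs_nonneg _) (hc i) 2) (sq_nonneg _)

lemma hasSum_starProjection (ho : Pairwise (F · ⟂ F ·))
    (hd : ⊤ ≤ (⨆ i, F i).topologicalClosure) (y : E) :
    HasSum (fun i => (F i).starProjection y) y := by
  classical
  have hs := IsHilbertSum.mkInternal F (OrthogonalFamily.of_pairwise fun i j hij => ho hij) hd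
  obtain ⟨w, rfl⟩ := hs.linearIsometryEquiv.symm.surjective y
  have hw := hs.hasSum_linearIsometryEquiv_symm w
  convert hw using 2 with i
  have hproj : HasSum (fun j => (F i).starProjection (w j : E)) (w i : E) := by
    rw [← Submodule.starProjection_eq_self_iff.2 (w i).2]
    refine hasSum_single i fun j hj => ?_
    rw [Submodule.starProjection_apply_eq_zero_iff]
    exact (ho hj).le (w j).2
  exact (hw.mapL (F i).starProjection).unique hproj

lemma hasSum_inner_starProjection (ho : Pairwise (F · ⟂ F ·))
    (hd : ⊤ ≤ (⨆ i, F i).topologicalClosure) (y z : E) :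
    HasSum (fun i => ⟪(F i).starProjection y, z⟫_ℝ) ⟪y, z⟫_ℝ := by
  simpa [real_inner_comm] using (hasSum_starProjection ho hd y).mapL (innerSL ℝ z)

lemma hasSum_sq_norm_starProjection (ho : Pairwise (F · ⟂ F ·))
    (hd : ⊤ ≤ (⨆ i, F i).topologicalClosure) (y : E) :
    HasSum (fun i => ‖(F i).starProjection y‖ ^ 2) (‖y‖ ^ 2) := by
  simpa only [inner_starProjection_eq_inner_starProjection, real_inner_self_eq_norm_sq] using
    hasSum_inner_starProjection ho hd y y

end OrthogonalFamily

section CardWeightedSums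

variable {ι : Type*} [DecidableEq ι] {c : Finset ι → ℝ}

lemma hasSum_ite_mem (S : Finset ι) (a : ℝ) :
    HasSum (fun k => if k ∈ S then a else 0) ((S.card : ℝ) * a) := by
  have h : HasSum (fun k => if k ∈ S then a else 0) (∑ k ∈ S, if k ∈ S then a else 0) :=
    hasSum_sum_of_ne_finset_zero fun k hk => if_neg hk
  simpa [Finset.sum_ite_mem] using h

lemma summable_ite_mem_prod (hc : Summable fun S : Finset ι => (S.card : ℝ) * |c S|) :
    Summable fun q : Finset ι × ι => if q.2 ∈ q.1 then c q.1 else 0 := by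
  refine Summable.of_norm ?_
  simp only [apply_ite norm, norm_zero, Real.norm_eq_abs]
  rw [summable_prod_of_nonneg fun q => by dsimp only; split_ifs <;> positivity]
  exact ⟨fun S => (hasSum_ite_mem S |c S|).summable,
    by simpa only [(hasSum_ite_mem _ _).tsum_eq] using hc⟩

lemma hasSum_of_hasSum_ite_mem (hc : Summable fun S : Finset ι => (S.card : ℝ) * |c S|)
    {d : ι → ℝ} (hd : ∀ k, HasSum (fun S : Finset ι => if k ∈ S then c S else 0) (d k)) :
    HasSum d (∑' S : Finset ι, (S.card : ℝ) * c S) := by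
  have hs := summable_ite_mem_prod hc
  have hS := hs.hasSum.prod_fiberwise fun S => hasSum_ite_mem S (c S)
  have hk := ((Equiv.prodComm ι (Finset ι)).hasSum_iff.2 hs.hasSum).prod_fiberwise hd
  rwa [hS.tsum_eq]

end CardWeightedSums

/-! ### Hoeffding spaces -/

section CoordProd

variable {ι : Type*} {α : ι → Type*} [∀ i, MeasurableSpace (α i)]

/-- Bounded measurable functions of mean zero: the factors of the products that span the Hoeffding
spaces. Boundedness makes these products multipliers of integrable functions. -/
structure IsCenteredBounded {β : Type*} [MeasurableSpace β] (ν : Measure β) (g : β → ℝ) :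
    Prop where
  measurable : Measurable g
  bounded : ∃ C, ∀ u, |g u| ≤ C
  integral_eq_zero : ∫ u, g u ∂ν = 0

/-- The product over `k ∈ S` of functions `g k` of the single coordinates. -/
def coordProd (S : Finset ι) (g : ∀ i, α i → ℝ) (ω : ∀ i, α i) : ℝ := ∏ k ∈ S, g k (ω k)

lemma isCenteredBounded_indicator_sub {β : Type*} [MeasurableSpace β] (ν : Measure β)
    [IsProbabilityMeasure ν] {A : Set β} (hA : MeasurableSet A) :
    IsCenteredBounded ν fun u => A.indicator 1 u - ν.real A := by
  refine ⟨(measurable_one.indicator hA).sub_const _, ⟨1 + |ν.real A|, fun u => ?_⟩, ?_⟩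
  · refine (abs_sub _ _).trans (add_le_add_left ?_ _)
    by_cases h : u ∈ A <;> simp [h]
  · rw [integral_sub ((integrable_const _).indicator hA) (integrable_const _)]
    simp [integral_indicator_one hA]

variable {μ : ∀ i, Measure (α i)} (S : Finset ι) {g : ∀ i, α i → ℝ}
  (hg : ∀ k, IsCenteredBounded (μ k) (g k))

include hg

lemma measurable_coordProd : Measurable (coordProd S g) :=
  Finset.measurable_fun_prod _ fun k _ => (hg k).measurable.comp (measurable_pi_apply k)

lemma exists_abs_coordProd_le : ∃ C, ∀ ω, |coordProd S g ω| ≤ C := by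
  choose C hC using fun k => (hg k).bounded
  refine ⟨∏ k ∈ S, C k, fun ω => ?_⟩
  rw [coordProd, Finset.abs_prod]
  exact Finset.prod_le_prod (fun k _ => abs_nonneg _) fun k _ => hC k _

variable {P : Measure (∀ i, α i)}

lemma memLp_coordProd [IsFiniteMeasure P] (p : ℝ≥0∞) : MemLp (coordProd S g) p P := by
  obtain ⟨C, hC⟩ := exists_abs_coordProd_le S hg
  exact .of_bound (measurable_coordProd S hg).aestronglyMeasurable C (ae_of_all _ hC)

lemma integrable_mul_coordProd {Y : (∀ i, α i) → ℝ} (hY : Integrable Y P) :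
    Integrable (fun ω => Y ω * coordProd S g ω) P := by
  obtain ⟨C, hC⟩ := exists_abs_coordProd_le S hg
  exact hY.mul_bdd (c := C) (measurable_coordProd S hg).aestronglyMeasurable (ae_of_all _ hC)

end CoordProd

lemma inner_eq_integral_mul {Ω : Type*} [MeasurableSpace Ω] {P : Measure Ω} {Y Z : Lp ℝ 2 P}
    {y z : Ω → ℝ} (hY : Y =ᵐ[P] y) (hZ : Z =ᵐ[P] z) : ⟪Y, Z⟫_ℝ = ∫ ω, y ω * z ω ∂P := by
  rw [L2.inner_def]
  refine integral_congr_ae ?_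
  filter_upwards [hY, hZ] with ω hYω hZω
  rw [hYω, hZω, real_inner_comm, RCLike.inner_apply, conj_trivial]

section HoeffdingSpace

variable {ι : Type*} {α : ι → Type*} [∀ i, MeasurableSpace (α i)] (P : Measure (∀ i, α i))
  (μ : ∀ i, Measure (α i))

/-- The classes in `L²` of the products over `k ∈ S` of centred functions of the coordinates. -/
def hoeffdingGenerators (S : Finset ι) : Set (Lp ℝ 2 P) :=
  {Z | ∃ g : ∀ i, α i → ℝ, (∀ k, IsCenteredBounded (μ k) (g k)) ∧ Z =ᵐ[P] coordProd S g}

/-- The Hoeffding space of `S`: the variables that depend on the coordinates in `S` only and are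
centred in each of them. -/
def hoeffdingSpace (S : Finset ι) : Submodule ℝ (Lp ℝ 2 P) :=
  (Submodule.span ℝ (hoeffdingGenerators P μ S)).topologicalClosure

instance (S : Finset ι) : CompleteSpace (hoeffdingSpace P μ S) := by
  unfold hoeffdingSpace; infer_instance

variable {P μ}

lemma starProjection_hoeffdingSpace_congr {S : Finset ι} {Y Z : Lp ℝ 2 P}
    (h : ∀ V ∈ hoeffdingGenerators P μ S, ⟪V, Y⟫_ℝ = ⟪V, Z⟫_ℝ) :
    (hoeffdingSpace P μ S).starProjection Y = (hoeffdingSpace P μ S).starProjection Z := by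
  rw [← sub_eq_zero, ← map_sub, Submodule.starProjection_apply_eq_zero_iff]
  refine mem_orthogonal_topologicalClosure_span.2 fun V hV => ?_
  rw [inner_sub_right, h V hV, sub_self]

lemma starProjection_hoeffdingSpace_empty_eq_zero {Y : Lp ℝ 2 P} (hY : ∫ ω, Y ω ∂P = 0) :
    (hoeffdingSpace P μ ∅).starProjection Y = 0 := by
  rw [← map_zero (hoeffdingSpace P μ ∅).starProjection]
  refine starProjection_hoeffdingSpace_congr ?_
  rintro V ⟨g, -, hV⟩
  rw [inner_eq_integral_mul hV (Filter.EventuallyEq.refl _ Y), inner_zero_right]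
  simpa [coordProd] using hY

end HoeffdingSpace

section Orthogonality

variable {ι : Type*} [DecidableEq ι] {α : ι → Type*}

lemma coordProd_update_of_mem {S : Finset ι} {k : ι} (hk : k ∈ S) (g : ∀ i, α i → ℝ)
    (ω : ∀ i, α i) (u : α k) :
    coordProd S g (update ω k u) = g k u * coordProd (S.erase k) g ω := by
  rw [coordProd, ← Finset.mul_prod_erase _ _ hk, Function.update_self]
  congr 1
  exact Finset.prod_congr rfl fun j hj => by rw [Function.update_of_ne (Finset.ne_of_mem_erase hj)]

lemma coordProd_update_of_notMem {S : Finset ι} {k : ι} (hk : k ∉ S) (g : ∀ i, α i → ℝ)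
    (ω : ∀ i, α i) (u : α k) : coordProd S g (update ω k u) = coordProd S g ω :=
  Finset.prod_congr rfl fun j hj => by rw [Function.update_of_ne (by rintro rfl; exact hk hj)]

variable [∀ i, MeasurableSpace (α i)] {P : Measure (∀ i, α i)} {μ : ∀ i, Measure (α i)}
  [IsProbabilityMeasure P] [∀ i, IsProbabilityMeasure (μ i)] [ResamplingInvariant P μ]

lemma integral_eq_zero_of_update_eq_mul (k : ι) {F R : (∀ i, α i) → ℝ} {g : α k → ℝ}
    (hF : Integrable F P) (hg : ∫ u, g u ∂μ k = 0)
    (h : ∀ ω u, F (update ω k u) = g u * R ω) : ∫ ω, F ω ∂P = 0 := by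
  rw [← integral_integral_update μ k hF]
  simp only [h, integral_mul_const, hg, zero_mul, integral_zero]

lemma integral_coordProd_mul_coordProd_of_not_subset {S T : Finset ι} (hST : ¬S ⊆ T)
    {g g' : ∀ i, α i → ℝ} (hg : ∀ k, IsCenteredBounded (μ k) (g k))
    (hg' : ∀ k, IsCenteredBounded (μ k) (g' k)) :
    ∫ ω, coordProd S g ω * coordProd T g' ω ∂P = 0 := by
  obtain ⟨k, hkS, hkT⟩ := Finset.not_subset.1 hST
  refine integral_eq_zero_of_update_eq_mul (μ := μ) k
    (R := fun ω => coordProd (S.erase k) g ω * coordProd T g' ω)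
    (integrable_mul_coordProd T hg' ((memLp_coordProd S hg 1).integrable le_rfl))
    (hg k).integral_eq_zero fun ω u => ?_
  rw [coordProd_update_of_mem hkS, coordProd_update_of_notMem hkT, mul_assoc]

lemma integral_coordProd_mul_coordProd_of_ne {S T : Finset ι} (hST : S ≠ T)
    {g g' : ∀ i, α i → ℝ} (hg : ∀ k, IsCenteredBounded (μ k) (g k))
    (hg' : ∀ k, IsCenteredBounded (μ k) (g' k)) :
    ∫ ω, coordProd S g ω * coordProd T g' ω ∂P = 0 := by
  by_cases h : S ⊆ T
  · simp_rw [mul_comm (coordProd S g _)]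
    exact integral_coordProd_mul_coordProd_of_not_subset
      (fun h' => hST (h.antisymm h')) hg' hg
  · exact integral_coordProd_mul_coordProd_of_not_subset h hg hg'

lemma integral_coordDiff_mul_coordProd (k : ι) (S : Finset ι) {g : ∀ i, α i → ℝ}
    (hg : ∀ k, IsCenteredBounded (μ k) (g k)) {Y : (∀ i, α i) → ℝ} (hY : MemLp Y 2 P) :
    ∫ ω, coordDiff μ k Y ω * coordProd S g ω ∂P =
      if k ∈ S then ∫ ω, Y ω * coordProd S g ω ∂P else 0 := by
  have hYS := integrable_mul_coordProd S hg (hY.integrable one_le_two)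
  have hAS := integrable_mul_coordProd S hg ((memLp_two_coordAvg μ k hY).integrable one_le_two)
  have split : ∫ ω, coordDiff μ k Y ω * coordProd S g ω ∂P =
      ∫ ω, Y ω * coordProd S g ω ∂P - ∫ ω, coordAvg μ k Y ω * coordProd S g ω ∂P := by
    simp only [coordDiff, sub_mul, integral_sub hYS hAS]
  rw [split]
  split_ifs with hk
  · rw [sub_eq_self]
    refine integral_eq_zero_of_update_eq_mul (μ := μ) k
      (R := fun ω => coordProd (S.erase k) g ω * coordAvg μ k Y ω)
      hAS (hg k).integral_eq_zero fun ω u => ?_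
    rw [coordProd_update_of_mem hk, coordAvg_update]
    ring
  · rw [sub_eq_zero, ← integral_integral_update μ k hYS]
    simp only [coordProd_update_of_notMem hk, integral_mul_const, coordAvg]

lemma pairwise_isOrtho_hoeffdingSpace :
    Pairwise (hoeffdingSpace P μ · ⟂ hoeffdingSpace P μ ·) := by
  refine fun S T hST => isOrtho_topologicalClosure_span ?_
  rintro Y ⟨g, hg, hY⟩ Z ⟨g', hg', hZ⟩
  rw [inner_eq_integral_mul hY hZ, integral_coordProd_mul_coordProd_of_ne hST hg hg']

end Orthogonality

lemma indicator_pi_eq_sum_coordProd {ι : Type*} [DecidableEq ι] {α : ι → Type*}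
    (s : Finset ι) (t : ∀ i, Set (α i)) (c : ι → ℝ) (ω : ∀ i, α i) :
    ((s : Set ι).pi t).indicator 1 ω =
      ∑ T ∈ s.powerset, coordProd T (fun k u => (t k).indicator 1 u - c k) ω *
        ∏ k ∈ s \ T, c k := by
  rw [Set.indicator_pi_one_apply]
  simpa only [coordProd, sub_add_cancel] using Finset.prod_add
    (fun k => (t k).indicator (1 : α k → ℝ) (ω k) - c k) c s

section Totality

variable {ι : Type*} {α : ι → Type*} [∀ i, MeasurableSpace (α i)] {P : Measure (∀ i, α i)}
  {μ : ∀ i, Measure (α i)} [∀ i, IsProbabilityMeasure (μ i)]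

/-- Expanding the indicator of a box into centred products makes `Y` orthogonal to it. -/
lemma setIntegral_pi_eq_zero {Y : (∀ i, α i) → ℝ} (hY : Integrable Y P)
    (h : ∀ (S : Finset ι) (g : ∀ i, α i → ℝ), (∀ k, IsCenteredBounded (μ k) (g k)) →
      ∫ ω, Y ω * coordProd S g ω ∂P = 0)
    (s : Finset ι) {t : ∀ i, Set (α i)} (ht : ∀ k, MeasurableSet (t k)) :
    ∫ ω in (s : Set ι).pi t, Y ω ∂P = 0 := by
  classical
  have hg := fun k => isCenteredBounded_indicator_sub (μ k) (ht k)
  have expand : ∀ ω, ((s : Set ι).pi t).indicator Y ω = ∑ T ∈ s.powerset,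
      (Y ω * coordProd T (fun k u => (t k).indicator 1 u - (μ k).real (t k)) ω) *
        ∏ k ∈ s \ T, (μ k).real (t k) := fun ω => by
    have hind : ((s : Set ι).pi t).indicator Y ω = Y ω * ((s : Set ι).pi t).indicator 1 ω := by
      rw [← Set.indicator_mul_right]
      simp only [Pi.one_apply, mul_one]
    rw [hind, indicator_pi_eq_sum_coordProd s t (fun k => (μ k).real (t k))]
    simp only [Finset.mul_sum, mul_assoc]
  rw [← integral_indicator (.pi s.countable_toSet fun i _ => ht i)]
  simp_rw [expand]
  rw [integral_finsetSum _ fun T _ => (integrable_mul_coordProd T hg hY).mul_const _]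
  refine Finset.sum_eq_zero fun T _ => ?_
  rw [integral_mul_const, h T _ hg, zero_mul]

variable [IsProbabilityMeasure P]

lemma ae_eq_zero_of_integral_mul_coordProd {Y : (∀ i, α i) → ℝ} (hY : Integrable Y P)
    (h : ∀ (S : Finset ι) (g : ∀ i, α i → ℝ), (∀ k, IsCenteredBounded (μ k) (g k)) →
      ∫ ω, Y ω * coordProd S g ω ∂P = 0) : Y =ᵐ[P] 0 := by
  have h0 : ∫ ω, Y ω ∂P = 0 := by
    simpa using setIntegral_pi_eq_zero hY h ∅ (t := fun _ => Set.univ) fun _ => .univ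
  refine hY.ae_eq_zero_of_forall_setIntegral_eq_zero fun A hA _ => ?_
  induction A, hA using MeasurableSpace.induction_on_inter
    (generateFrom_squareCylinders (α := α)).symm
    (isPiSystem_squareCylinders (fun _ => MeasurableSpace.isPiSystem_measurableSet)
      fun _ => by simp) with
  | empty => simp
  | basic A hA =>
    obtain ⟨s, t, ht, rfl⟩ := hA
    exact setIntegral_pi_eq_zero hY h s fun k => ht k (Set.mem_univ k)
  | compl A hA ih =>
    rw [setIntegral_compl hA hY, h0, ih (measure_lt_top _ _), sub_zero]
  | iUnion f hd hf ih =>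
    rw [integral_iUnion hf hd hY.integrableOn]
    simp [fun i => ih i (measure_lt_top _ _)]

lemma topologicalClosure_iSup_hoeffdingSpace :
    ⊤ ≤ (⨆ S, hoeffdingSpace P μ S).topologicalClosure := by
  rw [top_le_iff, Submodule.topologicalClosure_eq_top_iff, eq_bot_iff]
  intro Y hY
  rw [Submodule.mem_bot, Lp.eq_zero_iff_ae_eq_zero]
  refine ae_eq_zero_of_integral_mul_coordProd (μ := μ)
    ((Lp.memLp Y).integrable one_le_two) fun S g hg => ?_
  have hZ := (memLp_coordProd (P := P) S hg 2).coeFn_toLp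
  rw [← inner_eq_integral_mul (Filter.EventuallyEq.refl _ Y) hZ, real_inner_comm]
  refine (Submodule.mem_orthogonal _ _).1 hY _ (le_iSup (hoeffdingSpace P μ) S ?_)
  exact Submodule.le_topologicalClosure _ (Submodule.subset_span ⟨g, hg, hZ⟩)

end Totality

section OrnsteinUhlenbeck

variable {ι : Type*} [DecidableEq ι] {α : ι → Type*} [∀ i, MeasurableSpace (α i)]
  {P : Measure (∀ i, α i)} (μ : ∀ i, Measure (α i)) [IsProbabilityMeasure P]
  [∀ i, IsProbabilityMeasure (μ i)] [ResamplingInvariant P μ]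

/-- The operator `coordDiff` on classes in `L²`. -/
def coordDiffLp (k : ι) (Y : Lp ℝ 2 P) : Lp ℝ 2 P :=
  (memLp_two_coordDiff μ k (Lp.memLp Y)).toLp

lemma coeFn_coordDiffLp (k : ι) (Y : Lp ℝ 2 P) : coordDiffLp μ k Y =ᵐ[P] coordDiff μ k Y :=
  MemLp.coeFn_toLp _

lemma starProjection_hoeffdingSpace_coordDiffLp (k : ι) (S : Finset ι) (Y : Lp ℝ 2 P) :
    (hoeffdingSpace P μ S).starProjection (coordDiffLp μ k Y) =
      if k ∈ S then (hoeffdingSpace P μ S).starProjection Y else 0 := by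
  have inner_gen : ∀ V ∈ hoeffdingGenerators P μ S,
      ⟪V, coordDiffLp μ k Y⟫_ℝ = if k ∈ S then ⟪V, Y⟫_ℝ else 0 := by
    rintro V ⟨g, hg, hV⟩
    rw [real_inner_comm, real_inner_comm Y, inner_eq_integral_mul (coeFn_coordDiffLp μ k Y) hV,
      inner_eq_integral_mul (Filter.EventuallyEq.refl _ Y) hV,
      integral_coordDiff_mul_coordProd k S hg (Lp.memLp Y)]
  split_ifs with hk
  · exact starProjection_hoeffdingSpace_congr fun V hV => by rw [inner_gen V hV, if_pos hk]
  · rw [← map_zero (hoeffdingSpace P μ S).starProjection]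
    exact starProjection_hoeffdingSpace_congr fun V hV => by
      rw [inner_gen V hV, if_neg hk, inner_zero_right]

lemma hasSum_inner_coordDiffLp (k : ι) (Y Z : Lp ℝ 2 P) :
    HasSum (fun S => if k ∈ S then ⟪(hoeffdingSpace P μ S).starProjection Y, Z⟫_ℝ else 0)
      ⟪coordDiffLp μ k Y, Z⟫_ℝ := by
  convert hasSum_inner_starProjection (pairwise_isOrtho_hoeffdingSpace (μ := μ))
    topologicalClosure_iSup_hoeffdingSpace (coordDiffLp μ k Y) Z using 2 with S
  rw [starProjection_hoeffdingSpace_coordDiffLp]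
  split_ifs <;> simp

lemma hasSum_sq_norm_coordDiffLp (k : ι) (Y : Lp ℝ 2 P) :
    HasSum (fun S => if k ∈ S then ‖(hoeffdingSpace P μ S).starProjection Y‖ ^ 2 else 0)
      (‖coordDiffLp μ k Y‖ ^ 2) := by
  convert hasSum_sq_norm_starProjection (pairwise_isOrtho_hoeffdingSpace (μ := μ))
    topologicalClosure_iSup_hoeffdingSpace (coordDiffLp μ k Y) using 2 with S
  rw [starProjection_hoeffdingSpace_coordDiffLp]
  split_ifs <;> simp

/-- The equation `L W = X` for the Ornstein-Uhlenbeck operator `L`, which is multiplication by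
`-|S|` on the Hoeffding space of `S`. It leaves the mean of `W` free. -/
def IsOrnsteinUhlenbeckSolution (W X : Lp ℝ 2 P) : Prop :=
  ∀ S : Finset ι, (S.card : ℝ) • (hoeffdingSpace P μ S).starProjection W =
    -(hoeffdingSpace P μ S).starProjection X

namespace IsOrnsteinUhlenbeckSolution

variable {μ} {W X : Lp ℝ 2 P}

lemma summable_sq_norm_coordDiffLp (h : IsOrnsteinUhlenbeckSolution μ W X) :
    Summable fun k => ‖coordDiffLp μ k W‖ ^ 2 := by
  have hX := hasSum_sq_norm_starProjection pairwise_isOrtho_hoeffdingSpace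
    topologicalClosure_iSup_hoeffdingSpace (F := hoeffdingSpace P μ) X
  refine (hasSum_of_hasSum_ite_mem ?_ fun k => hasSum_sq_norm_coordDiffLp μ k W).summable
  refine hX.summable.of_nonneg_of_le (fun S => by positivity) fun S => ?_
  have norm_eq : (S.card : ℝ) * ‖(hoeffdingSpace P μ S).starProjection W‖ =
      ‖(hoeffdingSpace P μ S).starProjection X‖ := by
    simpa only [norm_smul, norm_neg, Real.norm_natCast] using congrArg norm (h S)
  have card_le_sq : (S.card : ℝ) ≤ S.card ^ 2 := by exact_mod_cast Nat.le_self_pow two_ne_zero _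
  rw [abs_of_nonneg (sq_nonneg _), ← norm_eq, mul_pow]
  gcongr

/-- Since `k` is in `S` for exactly `|S|` indices `k`, summing over `k` multiplies the component of
`W` in the Hoeffding space of `S` by `|S|`. -/
lemma hasSum_inner_coordDiffLp (h : IsOrnsteinUhlenbeckSolution μ W X) (Z : Lp ℝ 2 P) :
    HasSum (fun k => ⟪coordDiffLp μ k W, Z⟫_ℝ) (-⟪X, Z⟫_ℝ) := by
  have ho := pairwise_isOrtho_hoeffdingSpace (P := P) (μ := μ)
  have hd := topologicalClosure_iSup_hoeffdingSpace (P := P) (μ := μ)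
  have card_mul_inner_eq : ∀ S : Finset ι,
      (S.card : ℝ) * ⟪(hoeffdingSpace P μ S).starProjection W, Z⟫_ℝ =
        -⟪(hoeffdingSpace P μ S).starProjection X, Z⟫_ℝ := fun S => by
    rw [← real_inner_smul_left, h S, inner_neg_left]
  have hsum := hasSum_of_hasSum_ite_mem ?_ fun k =>
    HoeffdingDecomposition.hasSum_inner_coordDiffLp μ k W Z
  · simp_rw [card_mul_inner_eq] at hsum
    rwa [tsum_neg, (hasSum_inner_starProjection ho hd X Z).tsum_eq] at hsum
  · refine .of_nonneg_of_le (fun S => by positivity) (fun S => ?_)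
      ((hasSum_sq_norm_starProjection ho hd X).summable.add
        (hasSum_sq_norm_starProjection ho hd Z).summable)
    rw [← Nat.abs_cast (R := ℝ) S.card, ← abs_mul, card_mul_inner_eq, abs_neg,
      inner_starProjection_eq_inner_starProjection]
    refine (abs_real_inner_le_norm _ _).trans ?_
    set a := ‖(hoeffdingSpace P μ S).starProjection X‖
    set b := ‖(hoeffdingSpace P μ S).starProjection Z‖
    nlinarith [sq_nonneg (a - b), sq_nonneg (a + b)]

end IsOrnsteinUhlenbeckSolution

end OrnsteinUhlenbeck

/-! ### Covariances and second-order remainders in one coordinate -/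

lemma enorm_sq_eq_ofReal (y : ℝ) : ‖y‖ₑ ^ 2 = ENNReal.ofReal (y ^ 2) := by
  rw [Real.enorm_eq_ofReal_abs, ← ENNReal.ofReal_pow (abs_nonneg _), sq_abs]

lemma enorm_mul_le_of_abs_le_one {a : ℝ} (ha : |a| ≤ 1) (b : ℝ) : ‖a * b‖ₑ ≤ ‖b‖ₑ := by
  rw [enorm_mul, Real.enorm_eq_ofReal_abs]
  exact mul_le_of_le_one_left zero_le (ENNReal.ofReal_le_one.2 ha)

lemma mul_le_sq_add_sq (a b : ℝ≥0∞) : a * b ≤ a ^ 2 + b ^ 2 := by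
  rcases le_total a b with h | h
  · calc a * b ≤ b * b := by gcongr
      _ ≤ a ^ 2 + b ^ 2 := by rw [← sq]; exact le_add_self
  · calc a * b ≤ a * a := by gcongr
      _ ≤ a ^ 2 + b ^ 2 := by rw [← sq]; exact le_self_add

lemma lintegral_enorm_const_sub_sq {β : Type*} [MeasurableSpace β] {ν : Measure β}
    [IsProbabilityMeasure ν] {a : β → ℝ} (ha : MemLp a 2 ν) (h0 : ∫ v, a v ∂ν = 0) (c : ℝ) :
    ∫⁻ v, ‖c - a v‖ₑ ^ 2 ∂ν = ‖c‖ₑ ^ 2 + ∫⁻ v, ‖a v‖ₑ ^ 2 ∂ν := by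
  have hai : Integrable a ν := ha.integrable one_le_two
  have integral_sq : ∫ v, (c - a v) ^ 2 ∂ν = c ^ 2 + ∫ v, a v ^ 2 ∂ν := by
    have expand : ∀ v, (c - a v) ^ 2 = c ^ 2 - 2 * c * a v + a v ^ 2 := fun v => by ring
    simp_rw [expand]
    have hlin : Integrable (fun v => c ^ 2 - 2 * c * a v) ν :=
      (integrable_const _).sub (hai.const_mul _)
    rw [integral_add hlin ha.integrable_sq, integral_sub (integrable_const _) (hai.const_mul _),
      integral_const_mul, h0]
    simp
  have hca : MemLp (fun v => c - a v) 2 ν := (memLp_const c).sub ha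
  simp_rw [enorm_sq_eq_ofReal]
  rw [← ofReal_integral_eq_lintegral_ofReal hca.integrable_sq (ae_of_all _ fun v => sq_nonneg _),
    ← ofReal_integral_eq_lintegral_ofReal ha.integrable_sq (ae_of_all _ fun v => sq_nonneg _),
    ← ENNReal.ofReal_add (sq_nonneg _) (integral_nonneg fun v => sq_nonneg _)]
  exact congrArg _ integral_sq

section CoordCov

variable {ι : Type*} [DecidableEq ι] {α : ι → Type*} [∀ i, MeasurableSpace (α i)]
  (P : Measure (∀ i, α i)) (μ : ∀ i, Measure (α i))

/-- The conditional covariance of `x` and `w` given all coordinates but the `k`-th. -/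
def coordCov (k : ι) (x w : (∀ i, α i) → ℝ) (ω : ∀ i, α i) : ℝ :=
  ∫ u, coordDiff μ k x (update ω k u) * coordDiff μ k w (update ω k u) ∂μ k

/-- The error made when the increment of a function `f` of `x` under resampling of the coordinate
`k` is replaced by its linear part, up to half the Lipschitz constant of `f'`, and weighted by
`coordDiff μ k w`. -/
def coordRemainder (k : ι) (x w : (∀ i, α i) → ℝ) : ℝ≥0∞ :=
  ∫⁻ ω, (∫⁻ u, ‖coordDiff μ k w (update ω k u)‖ₑ * ‖x (update ω k u) - x ω‖ₑ ^ 2 ∂μ k) ∂P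

variable {P} {x w : (∀ i, α i) → ℝ} [∀ i, IsProbabilityMeasure (μ i)]

lemma tsum_lintegral_coordDiff_mul_lt_top (hmx : Measurable x)
    (hx : ∑' k, ∫⁻ ω, ‖coordDiff μ k x ω‖ₑ ^ 2 ∂P < ∞)
    (hw : ∑' k, ∫⁻ ω, ‖coordDiff μ k w ω‖ₑ ^ 2 ∂P < ∞) :
    ∑' k, ∫⁻ ω, ‖coordDiff μ k x ω‖ₑ * ‖coordDiff μ k w ω‖ₑ ∂P < ∞ := by
  refine lt_of_le_of_lt ?_ (ENNReal.add_lt_top.2 ⟨hx, hw⟩)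
  rw [← ENNReal.tsum_add]
  refine ENNReal.tsum_le_tsum fun k => ?_
  rw [← lintegral_add_left ((measurable_coordDiff μ k hmx).enorm.pow_const 2)]
  exact lintegral_mono fun ω => mul_le_sq_add_sq _ _

variable [ResamplingInvariant P μ]

lemma lintegral_enorm_coordCov_le (k : ι) (hmx : Measurable x) (hmw : Measurable w) :
    ∫⁻ ω, ‖coordCov μ k x w ω‖ₑ ∂P ≤ ∫⁻ ω, ‖coordDiff μ k x ω‖ₑ * ‖coordDiff μ k w ω‖ₑ ∂P := by
  have hm : Measurable fun ω => ‖coordDiff μ k x ω‖ₑ * ‖coordDiff μ k w ω‖ₑ :=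
    (measurable_coordDiff μ k hmx).enorm.mul (measurable_coordDiff μ k hmw).enorm
  rw [← lintegral_lintegral_update μ k hm]
  refine lintegral_mono fun ω => (enorm_integral_le_lintegral_enorm _).trans_eq ?_
  simp_rw [enorm_mul]

variable [IsProbabilityMeasure P]

lemma integrable_coordCov (k : ι) (hx : MemLp x 2 P) (hw : MemLp w 2 P) :
    Integrable (coordCov μ k x w) P :=
  (integrable_comp_update μ k ((memLp_two_coordDiff μ k hx).integrable_mul
    (memLp_two_coordDiff μ k hw))).integral_prod_left

/-- Subtracting a constant from `f (x ∘ update)` changes nothing, because `coordDiff μ k w` is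
centred in the coordinate `k`. -/
lemma ae_integral_coordDiff_mul_comp_sub (k : ι) (hmx : Measurable x) (hx : MemLp x 2 P)
    (hw : MemLp w 2 P) {f f' : ℝ → ℝ} (hf : Measurable f) (hf1 : ∀ y, |f y| ≤ 1) :
    ∀ᵐ ω ∂P, (∫ u, coordDiff μ k w (update ω k u) * f (x (update ω k u)) ∂μ k) -
        f' (x ω) * coordCov μ k x w ω =
      ∫ u, coordDiff μ k w (update ω k u) * (f (x (update ω k u)) - f (x ω) -
          f' (x ω) * (x (update ω k u) - x ω)) ∂μ k := by
  filter_upwards [ae_integral_coordDiff_update μ k hw, ae_memLp_two_coordDiff_update μ k hw,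
    ae_memLp_two_coordDiff_update μ k hx] with ω h0 hwω hxω
  have hwi := hwω.integrable one_le_two
  have hxw : Integrable
      (fun u => coordDiff μ k x (update ω k u) * coordDiff μ k w (update ω k u)) (μ k) :=
    hxω.integrable_mul hwω
  have hfm : Measurable fun u => f (x (update ω k u)) :=
    hf.comp (hmx.comp (measurable_update'.comp measurable_prodMk_left))
  have hwf : Integrable (fun u => coordDiff μ k w (update ω k u) * f (x (update ω k u))) (μ k) :=
    hwi.mul_bdd (c := 1) hfm.aestronglyMeasurable (ae_of_all _ fun u => hf1 _)
  have expand : ∀ u, coordDiff μ k w (update ω k u) * (f (x (update ω k u)) - f (x ω) -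
          f' (x ω) * (x (update ω k u) - x ω)) =
        coordDiff μ k w (update ω k u) * f (x (update ω k u)) -
          f' (x ω) * (coordDiff μ k x (update ω k u) * coordDiff μ k w (update ω k u)) -
          (f (x ω) + f' (x ω) * (coordAvg μ k x ω - x ω)) * coordDiff μ k w (update ω k u) := by
    intro u
    rw [coordDiff_update μ k x]
    ring
  simp_rw [expand]
  have hwf_sub : Integrable (fun u => coordDiff μ k w (update ω k u) * f (x (update ω k u)) -
      f' (x ω) * (coordDiff μ k x (update ω k u) * coordDiff μ k w (update ω k u))) (μ k) :=
    hwf.sub (hxw.const_mul _)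
  rw [integral_sub hwf_sub (hwi.const_mul _), integral_sub hwf (hxw.const_mul _),
    integral_const_mul, integral_const_mul, h0, mul_zero, sub_zero, coordCov]

lemma coordRemainder_eq (k : ι) (hmx : Measurable x) (hx : MemLp x 2 P) (hmw : Measurable w) :
    coordRemainder P μ k x w = (∫⁻ ω, ‖coordDiff μ k w ω‖ₑ * ‖coordDiff μ k x ω‖ₑ ^ 2 ∂P) +
      ∫⁻ ω, (∫⁻ u, ‖coordDiff μ k w (update ω k u)‖ₑ *
          ∫⁻ v, ‖coordDiff μ k x (update ω k v)‖ₑ ^ 2 ∂μ k ∂μ k) ∂P := by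
  have hdw := measurable_coordDiff μ k hmw
  have hdx := measurable_coordDiff μ k hmx
  have hmF : Measurable fun ω => ∫⁻ u, ‖coordDiff μ k w (update ω k u)‖ₑ *
      ‖x (update ω k u) - x ω‖ₑ ^ 2 ∂μ k := by
    refine Measurable.lintegral_prod_right' (f := fun p : (∀ i, α i) × α k =>
      ‖coordDiff μ k w (update p.1 k p.2)‖ₑ * ‖x (update p.1 k p.2) - x p.1‖ₑ ^ 2) ?_
    exact (hdw.comp measurable_update').enorm.mul
      (((hmx.comp measurable_update').sub (hmx.comp measurable_fst)).enorm.pow_const 2)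
  have hmG : Measurable fun ω => ‖coordDiff μ k w ω‖ₑ * ‖coordDiff μ k x ω‖ₑ ^ 2 :=
    hdw.enorm.mul (hdx.enorm.pow_const 2)
  have hmG' : Measurable fun ω => ∫⁻ u, ‖coordDiff μ k w (update ω k u)‖ₑ *
      ‖coordDiff μ k x (update ω k u)‖ₑ ^ 2 ∂μ k :=
    (hmG.comp measurable_update').lintegral_prod_right'
  rw [coordRemainder, ← lintegral_lintegral_update μ k hmF, ← lintegral_lintegral_update μ k hmG,
    ← lintegral_add_left hmG']
  refine lintegral_congr_ae ?_
  filter_upwards [ae_integral_coordDiff_update μ k hx, ae_memLp_two_coordDiff_update μ k hx]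
    with ω h0 hxω
  have update_sub : ∀ u v, x (update ω k u) - x (update ω k v) =
      coordDiff μ k x (update ω k u) - coordDiff μ k x (update ω k v) := fun u v => by
    rw [coordDiff_update, coordDiff_update, sub_sub_sub_cancel_right]
  have hω : Measurable (update ω k) := measurable_update ω
  simp only [Function.update_idem, update_sub]
  rw [lintegral_lintegral_swap, ← lintegral_add_left]
  · refine lintegral_congr fun u => ?_
    have hsub : Measurable fun v => ‖coordDiff μ k x (update ω k u) -
        coordDiff μ k x (update ω k v)‖ₑ ^ 2 :=
      (measurable_const.sub (hdx.comp hω)).enorm.pow_const 2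
    rw [lintegral_const_mul _ hsub, lintegral_enorm_const_sub_sq hxω h0, mul_add]
  · exact hmG.comp hω
  · exact ((hdw.comp (hω.comp measurable_snd)).enorm.mul
      (((hdx.comp (hω.comp measurable_snd)).sub
        (hdx.comp (hω.comp measurable_fst))).enorm.pow_const 2)).aemeasurable

lemma enorm_integral_sub_le_coordRemainder (k : ι) (hmx : Measurable x) (hx : MemLp x 2 P)
    (hw : MemLp w 2 P) {h f f' : ℝ → ℝ} (hs : SteinEquation.IsBoundedSolution h f f') :
    ‖(∫ ω, coordDiff μ k w ω * f (x ω) ∂P) - ∫ ω, f' (x ω) * coordCov μ k x w ω ∂P‖ₑ ≤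
      coordRemainder P μ k x w := by
  have hwf : Integrable (fun ω => coordDiff μ k w ω * f (x ω)) P :=
    ((memLp_two_coordDiff μ k hw).integrable one_le_two).mul_bdd (c := 1)
      (hs.continuous.measurable.comp hmx).aestronglyMeasurable
      (ae_of_all _ fun ω => hs.abs_le_one _)
  have hf'c : Integrable (fun ω => f' (x ω) * coordCov μ k x w ω) P :=
    (integrable_coordCov μ k hx hw).bdd_mul (c := 1)
      (hs.lipschitzWith_deriv.continuous.measurable.comp hmx).aestronglyMeasurable
      (ae_of_all _ fun ω => hs.abs_deriv_le_one _)
  rw [← integral_integral_update μ k hwf,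
    ← integral_sub (integrable_comp_update μ k hwf).integral_prod_left hf'c,
    integral_congr_ae (ae_integral_coordDiff_mul_comp_sub (f' := f') μ k hmx hx hw
      hs.continuous.measurable hs.abs_le_one)]
  refine (enorm_integral_le_lintegral_enorm _).trans (lintegral_mono fun ω => ?_)
  refine (enorm_integral_le_lintegral_enorm _).trans (lintegral_mono fun u => ?_)
  rw [enorm_mul, enorm_sq_eq_ofReal, Real.enorm_eq_ofReal_abs (f _ - _ - _)]
  gcongr
  exact hs.abs_sub_sub_le_sq _ _

lemma lintegral_enorm_sq_coordDiff (k : ι) (Y : Lp ℝ 2 P) :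
    ∫⁻ ω, ‖coordDiff μ k Y ω‖ₑ ^ 2 ∂P = ENNReal.ofReal (‖coordDiffLp μ k Y‖ ^ 2) := by
  simp_rw [enorm_sq_eq_ofReal]
  rw [← ofReal_integral_eq_lintegral_ofReal
      (memLp_two_coordDiff μ k (Lp.memLp Y)).integrable_sq (ae_of_all _ fun v => sq_nonneg _),
    ← real_inner_self_eq_norm_sq,
    inner_eq_integral_mul (coeFn_coordDiffLp μ k Y) (coeFn_coordDiffLp μ k Y)]
  simp_rw [sq]

end CoordCov

section SteinBound

variable {β κ : Type*} [MeasurableSpace β] {ν : Measure β} [Countable κ]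

lemma hasSum_integral_of_tsum_lintegral_enorm_ne_top {F : κ → β → ℝ}
    (hm : ∀ i, AEStronglyMeasurable (F i) ν) (hF : ∑' i, ∫⁻ a, ‖F i a‖ₑ ∂ν ≠ ∞) :
    HasSum (fun i => ∫ a, F i a ∂ν) (∫ a, ∑' i, F i a ∂ν) := by
  rw [integral_tsum hm hF]
  refine Summable.hasSum (.of_norm_bounded (ENNReal.summable_toReal hF) fun i => ?_)
  rw [← toReal_enorm]
  exact ENNReal.toReal_mono (ENNReal.ne_top_of_tsum_ne_top hF i)
    (enorm_integral_le_lintegral_enorm _)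

lemma integrable_tsum_of_tsum_lintegral_enorm_ne_top {F : κ → β → ℝ}
    (hm : ∀ i, AEStronglyMeasurable (F i) ν) (hF : ∑' i, ∫⁻ a, ‖F i a‖ₑ ∂ν ≠ ∞) :
    Integrable (fun a => ∑' i, F i a) ν := by
  refine ⟨(AEMeasurable.tsum fun i => (hm i).aemeasurable).aestronglyMeasurable, ?_⟩
  rw [← lintegral_tsum fun i => (hm i).enorm] at hF
  exact (lintegral_mono fun a => enorm_tsum_le_tsum_enorm).trans_lt hF.lt_top

variable {ι : Type*} [DecidableEq ι] {α : ι → Type*} [∀ i, MeasurableSpace (α i)]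
  {P : Measure (∀ i, α i)} {μ : ∀ i, Measure (α i)} [IsProbabilityMeasure P]
  [∀ i, IsProbabilityMeasure (μ i)] [ResamplingInvariant P μ] {W X : Lp ℝ 2 P}

lemma IsOrnsteinUhlenbeckSolution.tsum_lintegral_enorm_sq_coordDiff_lt_top
    (h : IsOrnsteinUhlenbeckSolution μ W X) :
    ∑' k, ∫⁻ ω, ‖coordDiff μ k W ω‖ₑ ^ 2 ∂P < ∞ := by
  simp_rw [lintegral_enorm_sq_coordDiff]
  exact h.summable_sq_norm_coordDiffLp.tsum_ofReal_lt_top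

lemma IsOrnsteinUhlenbeckSolution.hasSum_integral_coordDiff_mul
    (h : IsOrnsteinUhlenbeckSolution μ W X) {z : (∀ i, α i) → ℝ} (hz : MemLp z 2 P) :
    HasSum (fun k => ∫ ω, coordDiff μ k W ω * z ω ∂P) (-∫ ω, X ω * z ω ∂P) := by
  rw [← inner_eq_integral_mul (Filter.EventuallyEq.refl _ X) hz.coeFn_toLp]
  convert h.hasSum_inner_coordDiffLp hz.toLp using 2 with k
  rw [inner_eq_integral_mul (coeFn_coordDiffLp μ k W) hz.coeFn_toLp]

/-- Stein's method: `E[X f(X)]` is the sum over `k` of the expectations of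
`-coordDiff μ k W * f(X)`, each of which is `-E[f'(X) * coordCov μ k X W]` up to the remainder. -/
theorem IsOrnsteinUhlenbeckSolution.enorm_integral_map_sub_integral_gaussianReal_le [Countable ι]
    (hW : IsOrnsteinUhlenbeckSolution μ W X) (hX : ∑' k, ∫⁻ ω, ‖coordDiff μ k X ω‖ₑ ^ 2 ∂P < ∞)
    {h : ℝ → ℝ} (hh : LipschitzWith 1 h) :
    ‖∫ y, h y ∂(P.map X) - ∫ y, h y ∂(gaussianReal 0 1)‖ₑ ≤
      (∫⁻ ω, ‖1 + ∑' k, coordCov μ k X W ω‖ₑ ∂P) + ∑' k, coordRemainder P μ k X W := by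
  obtain ⟨f, f', hs⟩ := SteinEquation.exists_isBoundedSolution hh
  have hmx : Measurable X := (Lp.stronglyMeasurable X).measurable
  have hmw : Measurable W := (Lp.stronglyMeasurable W).measurable
  have hmf' : Measurable fun ω => f' (X ω) := hs.lipschitzWith_deriv.continuous.measurable.comp hmx
  have hfX : MemLp (fun ω => f (X ω)) 2 P :=
    .of_bound (hs.continuous.measurable.comp hmx).aestronglyMeasurable 1
      (ae_of_all _ fun ω => hs.abs_le_one _)
  have hf'X : Integrable (fun ω => f' (X ω)) P :=
    .of_bound hmf'.aestronglyMeasurable 1 (ae_of_all _ fun ω => hs.abs_deriv_le_one _)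
  set F : ι → (∀ i, α i) → ℝ := fun k ω => f' (X ω) * coordCov μ k X W ω
  have hFm : ∀ k, AEStronglyMeasurable (F k) P := fun k => hmf'.aestronglyMeasurable.mul
    (integrable_coordCov μ k (Lp.memLp X) (Lp.memLp W)).aestronglyMeasurable
  have hF : ∑' k, ∫⁻ ω, ‖F k ω‖ₑ ∂P ≠ ∞ := by
    refine ne_top_of_le_ne_top (tsum_lintegral_coordDiff_mul_lt_top μ hmx hX
      hW.tsum_lintegral_enorm_sq_coordDiff_lt_top).ne (ENNReal.tsum_le_tsum fun k => ?_)
    exact (lintegral_mono fun ω => enorm_mul_le_of_abs_le_one (hs.abs_deriv_le_one _) _).trans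
      (lintegral_enorm_coordCov_le μ k hmx hmw)
  have stein_eq : ∫ y, h y ∂(P.map X) - ∫ y, h y ∂(gaussianReal 0 1) =
      (∫ ω, f' (X ω) * (1 + ∑' k, coordCov μ k X W ω) ∂P) +
        ∑' k, ((∫ ω, coordDiff μ k W ω * f (X ω) ∂P) - ∫ ω, F k ω ∂P) := by
    rw [((hW.hasSum_integral_coordDiff_mul hfX).sub
        (hasSum_integral_of_tsum_lintegral_enorm_ne_top hFm hF)).tsum_eq,
      hs.integral_map_sub_integral_gaussianReal ((Lp.memLp X).integrable one_le_two)]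
    simp_rw [mul_add, mul_one, ← tsum_mul_left]
    rw [integral_add hf'X (integrable_tsum_of_tsum_lintegral_enorm_ne_top hFm hF)]
    ring
  rw [stein_eq]
  refine (enorm_add_le _ _).trans (add_le_add ?_ ?_)
  · exact (enorm_integral_le_lintegral_enorm _).trans
      (lintegral_mono fun ω => enorm_mul_le_of_abs_le_one (hs.abs_deriv_le_one _) _)
  · exact enorm_tsum_le_tsum_enorm.trans (ENNReal.tsum_le_tsum fun k =>
      enorm_integral_sub_le_coordRemainder μ k hmx (Lp.memLp X) (Lp.memLp W) hs)

end SteinBound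

end HoeffdingDecomposition

namespace UniformSeq

open Function (update)
open scoped InnerProductSpace
open HoeffdingDecomposition

local notation "unifs" => (fun _ : ℕ => unif)

instance : ResamplingInvariant P unifs := by unfold P; infer_instance

/-! ### Blocks of the half-line -/

lemma unif_eq_smul_restrict_Ico :
    unif = (2 : ℝ≥0∞)⁻¹ • volume.restrict (Set.Ico (-1 : ℝ) 1) := by
  unfold unif ProbabilityTheory.cond
  rw [Real.volume_Icc, restrict_Ico_eq_restrict_Icc]
  norm_num

lemma ae_unif_mem_Ico : ∀ᵐ u ∂unif, u ∈ Set.Ico (-1 : ℝ) 1 := by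
  rw [unif_eq_smul_restrict_Ico]
  exact Measure.ae_smul_measure (ae_restrict_mem measurableSet_Ico) _

/-- The half-open block of index `k`, so that `block t = indexBlock ⌊t / 2⌋₊`. -/
def indexBlock (k : ℕ) : Set ℝ := Set.Ico (2 * (k : ℝ)) (2 * k + 2)

lemma measurableSet_indexBlock (k : ℕ) : MeasurableSet (indexBlock k) := measurableSet_Ico

lemma mem_indexBlock_iff {k : ℕ} {t : ℝ} : t ∈ indexBlock k ↔ 0 ≤ t ∧ ⌊t / 2⌋₊ = k := by
  rw [indexBlock, Set.mem_Ico]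
  refine ⟨fun h => ?_, fun ⟨h₀, h⟩ => ?_⟩
  · have ht : 0 ≤ t := by linarith [h.1, k.cast_nonneg (α := ℝ)]
    refine ⟨ht, (Nat.floor_eq_iff (by linarith)).2 ?_⟩
    constructor <;> linarith [h.1, h.2]
  · rw [Nat.floor_eq_iff (by linarith only [h₀])] at h
    constructor <;> linarith [h.1, h.2]

lemma pairwise_disjoint_indexBlock : Pairwise (Function.onFun Disjoint indexBlock) := by
  intro i j hij
  refine Set.disjoint_left.2 fun t hi hj => hij ?_
  rw [← (mem_indexBlock_iff.1 hi).2, (mem_indexBlock_iff.1 hj).2]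

lemma iUnion_indexBlock : ⋃ k, indexBlock k = Set.Ici (0 : ℝ) := by
  ext t
  simp [mem_indexBlock_iff]

lemma add_mem_indexBlock {u : ℝ} (hu : u ∈ Set.Ico (-1 : ℝ) 1) (k : ℕ) :
    2 * (k : ℝ) + 1 + u ∈ indexBlock k := by
  constructor <;> linarith [hu.1, hu.2]

lemma measurableEmbedding_shift (k : ℕ) :
    MeasurableEmbedding fun u : ℝ => 2 * (k : ℝ) + 1 + u :=
  measurableEmbedding_addLeft _

lemma map_shift_unif (k : ℕ) :
    unif.map (fun u => 2 * (k : ℝ) + 1 + u) =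
      (2 : ℝ≥0∞)⁻¹ • volume.restrict (indexBlock k) := by
  have h := (measurePreserving_add_left (volume : Measure ℝ)
    (2 * (k : ℝ) + 1)).restrict_preimage (measurableSet_indexBlock k)
  have preimage_eq : (fun u : ℝ => 2 * (k : ℝ) + 1 + u) ⁻¹' indexBlock k = Set.Ico (-1) 1 := by
    ext u
    simp only [indexBlock, Set.mem_preimage, Set.mem_Ico]
    constructor <;> rintro ⟨h₁, h₂⟩ <;> constructor <;> linarith
  rw [preimage_eq] at h
  rw [unif_eq_smul_restrict_Ico, Measure.map_smul, h.map_eq]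

lemma restrict_indexBlock (k : ℕ) :
    volume.restrict (indexBlock k) =
      (2 : ℝ≥0∞) • unif.map (fun u => 2 * (k : ℝ) + 1 + u) := by
  rw [map_shift_unif, smul_smul, ENNReal.mul_inv_cancel (by simp) (by simp), one_smul]

lemma setLIntegral_indexBlock (k : ℕ) (F : ℝ → ℝ≥0∞) :
    ∫⁻ t in indexBlock k, F t = 2 * ∫⁻ u, F (2 * (k : ℝ) + 1 + u) ∂unif := by
  rw [restrict_indexBlock, lintegral_smul_measure, (measurableEmbedding_shift k).lintegral_map,
    smul_eq_mul]

lemma setIntegral_indexBlock (k : ℕ) (F : ℝ → ℝ) :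
    ∫ t in indexBlock k, F t = 2 * ∫ u, F (2 * (k : ℝ) + 1 + u) ∂unif := by
  rw [restrict_indexBlock, integral_smul_measure, (measurableEmbedding_shift k).integral_map]
  simp

lemma setLIntegral_Ici_eq_tsum (F : ℝ → ℝ≥0∞) :
    ∫⁻ t in Set.Ici (0 : ℝ), F t = ∑' k : ℕ, 2 * ∫⁻ u, F (2 * (k : ℝ) + 1 + u) ∂unif := by
  simp_rw [← iUnion_indexBlock, ← setLIntegral_indexBlock]
  exact lintegral_iUnion measurableSet_indexBlock pairwise_disjoint_indexBlock F

lemma hasSum_setIntegral_Ici {F : ℝ → ℝ} (hF : IntegrableOn F (Set.Ici 0)) :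
    HasSum (fun k : ℕ => 2 * ∫ u, F (2 * (k : ℝ) + 1 + u) ∂unif)
      (∫ t in Set.Ici (0 : ℝ), F t) := by
  simp_rw [← iUnion_indexBlock, ← setIntegral_indexBlock] at hF ⊢
  exact hasSum_integral_iUnion measurableSet_indexBlock pairwise_disjoint_indexBlock hF

lemma block_shift (k : ℕ) {u : ℝ} (hu : u ∈ Set.Ico (-1 : ℝ) 1) :
    block (2 * (k : ℝ) + 1 + u) = indexBlock k := by
  rw [block, (mem_indexBlock_iff.1 (add_mem_indexBlock hu k)).2, indexBlock]

lemma Psi_shift (k : ℕ) {u : ℝ} (hu : u ∈ Set.Ico (-1 : ℝ) 1) (ω : Ω) :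
    Psi (2 * (k : ℝ) + 1 + u) ω = update ω k u := by
  rw [Psi, (mem_indexBlock_iff.1 (add_mem_indexBlock hu k)).2]
  congr 1
  ring

lemma setIntegral_comp_Psi (k : ℕ) (x : Ω → ℝ) (ω : Ω) :
    ∫ s in indexBlock k, x (Psi s ω) = 2 * coordAvg unifs k x ω := by
  rw [setIntegral_indexBlock]
  congr 1
  refine integral_congr_ae ?_
  filter_upwards [ae_unif_mem_Ico] with v hv using by rw [Psi_shift k hv]

lemma nabla_shift (k : ℕ) {u : ℝ} (hu : u ∈ Set.Ico (-1 : ℝ) 1) (x : Ω → ℝ) (ω : Ω) :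
    nabla (2 * (k : ℝ) + 1 + u) x ω = coordDiff unifs k x (update ω k u) := by
  rw [coordDiff_update, nabla, Psi_shift k hu, block_shift k hu, setIntegral_comp_Psi]
  ring

lemma measurable_Psi : Measurable fun p : ℝ × Ω => Psi p.1 p.2 := by
  refine measurable_pi_lambda _ fun j => ?_
  have floor : Measurable fun p : ℝ × Ω => ⌊p.1 / 2⌋₊ :=
    Nat.measurable_floor.comp (measurable_fst.div_const 2)
  simp only [Psi, Function.update_apply]
  refine Measurable.ite (measurableSet_eq_fun measurable_const floor) ?_ ?_
  · exact (measurable_fst.sub ((measurable_from_nat.comp floor).const_mul 2)).sub_const 1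
  · exact (measurable_pi_apply j).comp measurable_snd

lemma measurable_nabla {x : Ω → ℝ} (hx : Measurable x) :
    Measurable fun p : ℝ × Ω => nabla p.1 x p.2 := by
  have average : Measurable fun q : ℕ × Ω => ∫ s in indexBlock q.1, x (Psi s q.2) :=
    measurable_from_prod_countable_right fun k =>
      (StronglyMeasurable.integral_prod_left' (μ := volume.restrict (indexBlock k))
        (hx.comp measurable_Psi).stronglyMeasurable).measurable
  have floor : Measurable fun p : ℝ × Ω => (⌊p.1 / 2⌋₊, p.2) :=
    (Nat.measurable_floor.comp (measurable_fst.div_const 2)).prodMk measurable_snd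
  exact (hx.comp measurable_Psi).sub ((average.comp floor).const_mul _)

/-! ### Hoeffding spaces lie in the chaoses -/

/-- The function `g` of the coordinate `ω k`, as a function of the point `2k + 1 + ω k` of the
block of index `k`, extended by zero. -/
def onBlock (k : ℕ) (g : ℝ → ℝ) : ℝ → ℝ := (indexBlock k).indicator fun t => g (t - 2 * k - 1)

lemma onBlock_of_notMem {k : ℕ} {t : ℝ} (ht : t ∉ indexBlock k) (g : ℝ → ℝ) :
    onBlock k g t = 0 := Set.indicator_of_notMem ht _

lemma onBlock_shift {u : ℝ} (hu : u ∈ Set.Ico (-1 : ℝ) 1) (g : ℝ → ℝ) (j k : ℕ) :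
    onBlock j g (2 * (k : ℝ) + 1 + u) = if j = k then g u else 0 := by
  have h := add_mem_indexBlock hu k
  split_ifs with hjk
  · subst hjk
    rw [onBlock, Set.indicator_of_mem h]
    congr 1
    ring
  · refine onBlock_of_notMem (fun h' => hjk ?_) g
    rw [← (mem_indexBlock_iff.1 h).2, (mem_indexBlock_iff.1 h').2]

lemma measurable_onBlock (k : ℕ) {g : ℝ → ℝ} (hg : Measurable g) : Measurable (onBlock k g) :=
  (hg.comp ((measurable_id.sub_const _).sub_const _)).indicator (measurableSet_indexBlock k)

lemma abs_onBlock_le (k : ℕ) {g : ℝ → ℝ} {C : ℝ} (hC : ∀ u, |g u| ≤ C) (t : ℝ) :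
    |onBlock k g t| ≤ C := by
  by_cases h : t ∈ indexBlock k
  · rw [onBlock, Set.indicator_of_mem h]
    exact hC _
  · rw [onBlock_of_notMem h, abs_zero]
    exact (abs_nonneg _).trans (hC 0)

lemma memLp_onBlock (k : ℕ) {g : ℝ → ℝ} (hm : Measurable g) (hb : ∃ C, ∀ u, |g u| ≤ C)
    (p : ℝ≥0∞) : MemLp (onBlock k g) p := by
  obtain ⟨C, hC⟩ := hb
  have : IsFiniteMeasure (volume.restrict (indexBlock k)) := by
    rw [indexBlock]
    infer_instance
  exact (memLp_indicator_iff_restrict (measurableSet_indexBlock k)).2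
    (.of_bound (hm.comp ((measurable_id.sub_const _).sub_const _)).aestronglyMeasurable C
      (ae_of_all _ fun t => hC _))

lemma integral_onBlock (k : ℕ) {g : ℝ → ℝ} (hg : IsCenteredBounded unif g) :
    ∫ t, onBlock k g t = 0 := by
  have shift_back : ∀ u : ℝ, 2 * (k : ℝ) + 1 + u - 2 * k - 1 = u := fun u => by ring
  simp only [onBlock, integral_indicator (measurableSet_indexBlock k), setIntegral_indexBlock,
    shift_back, hg.integral_eq_zero, mul_zero]

section Join

variable {n r : ℕ}

/-- The decomposition of `Fin n` into its first `r` and its last `n - r` elements. -/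
def finSplit (hr : r ≤ n) : Fin r ⊕ Fin (n - r) ≃ Fin n :=
  finSumFinEquiv.trans (finCongr (Nat.add_sub_cancel' hr))

lemma finSplit_inl (hr : r ≤ n) (i : Fin r) : finSplit hr (Sum.inl i) = Fin.castLE hr i := rfl

/-- The concatenation of two vectors; thus `mixedPoint ω k y = join (blockPoint k ω) y`. -/
def join (x : Fin r → ℝ) (y : Fin (n - r) → ℝ) : Fin n → ℝ :=
  fun i => if h : (i : ℕ) < r then x ⟨i, h⟩ else y ⟨i - r, by omega⟩

lemma join_castLE (hr : r ≤ n) (x : Fin r → ℝ) (y : Fin (n - r) → ℝ) (i : Fin r) :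
    join x y (Fin.castLE hr i) = x i := by
  simp [join]

lemma join_finSplit_inr (hr : r ≤ n) (x : Fin r → ℝ) (y : Fin (n - r) → ℝ) (i : Fin (n - r)) :
    join x y (finSplit hr (Sum.inr i)) = y i := by
  simp [join, finSplit]

lemma prod_join (hr : r ≤ n) (φ : Fin n → ℝ → ℝ) (x : Fin r → ℝ) (y : Fin (n - r) → ℝ) :
    ∏ i, φ i (join x y i) =
      (∏ i, φ (Fin.castLE hr i) (x i)) * ∏ i, φ (finSplit hr (Sum.inr i)) (y i) := by
  rw [← (finSplit hr).prod_comp, Fintype.prod_sum_type]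
  simp only [finSplit_inl, join_castLE, join_finSplit_inr]

lemma integral_prod_join (hr : r ≤ n) (φ : Fin n → ℝ → ℝ) (x : Fin r → ℝ) :
    ∫ y : Fin (n - r) → ℝ, ∏ i, φ i (join x y i) =
      (∏ i, φ (Fin.castLE hr i) (x i)) * ∏ i, ∫ t, φ (finSplit hr (Sum.inr i)) t := by
  simp only [prod_join hr, integral_const_mul]
  rw [integral_fintype_prod_volume_eq_prod (fun i => φ (finSplit hr (Sum.inr i)))]

end Join

/-- The point `(2k_1 + 1 + U_{k_1}, …, 2k_r + 1 + U_{k_r})`. -/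
def blockPoint {r : ℕ} (k : Fin r → ℕ) (ω : Ω) : Fin r → ℝ :=
  fun i => 2 * (k i : ℝ) + 1 + ω (k i)

lemma ae_forall_mem_Ico : ∀ᵐ ω ∂P, ∀ k : ℕ, ω k ∈ Set.Ico (-1 : ℝ) 1 :=
  ae_all_iff.2 fun k => (measurePreserving_eval_infinitePi unifs k).quasiMeasurePreserving.ae
    ae_unif_mem_Ico

/-- The symmetrised tensor product of the functions `g (j i)` on the blocks of indices `j i`. -/
def symKernel {n : ℕ} (j : Fin n → ℕ) (g : ℕ → ℝ → ℝ) (x : Fin n → ℝ) : ℝ :=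
  ∑ σ : Equiv.Perm (Fin n), ∏ i, onBlock (j (σ i)) (g (j (σ i))) (x i)

section SymKernel

variable {n : ℕ} {j : Fin n → ℕ} {g : ℕ → ℝ → ℝ}

lemma symKernel_comp_perm (τ : Equiv.Perm (Fin n)) (x : Fin n → ℝ) :
    symKernel j g (x ∘ τ) = symKernel j g x := by
  refine Fintype.sum_equiv (Equiv.mulRight τ⁻¹) _ _ fun σ => ?_
  exact Fintype.prod_equiv τ _ _ fun i => by simp

lemma symKernel_of_notMem_Delta (hj : Function.Injective j) {x : Fin n → ℝ} (hx : x ∉ Delta n) :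
    symKernel j g x = 0 := by
  refine Finset.sum_eq_zero fun σ _ => ?_
  obtain ⟨i, hi⟩ : ∃ i, x i ∉ indexBlock (j (σ i)) := by
    by_contra! h
    exact hx (Set.mem_iUnion.2 ⟨⟨fun i => j (σ i), hj.comp σ.injective⟩,
      fun i _ => Set.Ico_subset_Icc_self (h i)⟩)
  exact Finset.prod_eq_zero (Finset.mem_univ i) (onBlock_of_notMem hi _)

lemma symKernel_blockPoint {ω : Ω} (hω : ∀ k : ℕ, ω k ∈ Set.Ico (-1 : ℝ) 1) (k : Fin n → ℕ) :
    symKernel j g (blockPoint k ω) =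
      ∑ σ : Equiv.Perm (Fin n), if k = j ∘ σ then ∏ i, g (j i) (ω (j i)) else 0 := by
  refine Finset.sum_congr rfl fun σ _ => ?_
  simp only [blockPoint, onBlock_shift (hω _)]
  split_ifs with h
  · subst h
    simpa using Equiv.prod_comp σ fun i => g (j i) (ω (j i))
  · obtain ⟨i, hi⟩ := Function.ne_iff.1 h
    exact Finset.prod_eq_zero (Finset.mem_univ i) (if_neg (Ne.symm hi))

lemma hasSum_symKernel_blockPoint (hj : Function.Injective j) {ω : Ω}
    (hω : ∀ k : ℕ, ω k ∈ Set.Ico (-1 : ℝ) 1) :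
    HasSum (fun k : Fin n ↪ ℕ => symKernel j g (blockPoint k ω))
      (n.factorial * ∏ i, g (j i) (ω (j i))) := by
  simp_rw [symKernel_blockPoint hω]
  have hσ : ∀ σ : Equiv.Perm (Fin n), HasSum (fun k : Fin n ↪ ℕ =>
      if (k : Fin n → ℕ) = j ∘ σ then ∏ i, g (j i) (ω (j i)) else 0)
      (∏ i, g (j i) (ω (j i))) := fun σ => by
    simpa using hasSum_single (f := fun k : Fin n ↪ ℕ => if (k : Fin n → ℕ) = j ∘ σ then
      ∏ i, g (j i) (ω (j i)) else 0) ⟨j ∘ σ, hj.comp σ.injective⟩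
      fun k hk => if_neg fun h => hk (DFunLike.ext' h)
  simpa [Fintype.card_perm] using hasSum_sum fun σ (_ : σ ∈ Finset.univ) => hσ σ

variable (hg : ∀ k, IsCenteredBounded unif (g k))

include hg

lemma integrable_onBlock (k : ℕ) : Integrable (onBlock k (g k)) :=
  memLp_one_iff_integrable.1 (memLp_onBlock k (hg k).measurable (hg k).bounded 1)

lemma isKernel_symKernel (hj : Function.Injective j) : IsKernel n (symKernel j g) := by
  have hint : ∀ σ : Equiv.Perm (Fin n), Integrable fun x : Fin n → ℝ =>
      ∏ i, onBlock (j (σ i)) (g (j (σ i))) (x i) := fun σ =>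
    .fintype_prod fun i => integrable_onBlock hg _
  refine ⟨symKernel_comp_perm, fun x => symKernel_of_notMem_Delta hj,
    integrable_finsetSum _ fun σ _ => hint σ, memLp_finsetSum _ fun σ _ => ?_⟩
  rw [memLp_two_iff_integrable_sq (hint σ).aestronglyMeasurable]
  simp_rw [← Finset.prod_pow]
  exact .fintype_prod fun i =>
    (memLp_onBlock (j (σ i)) (hg _).measurable (hg _).bounded 2).integrable_sq

lemma integral_symKernel_join_of_lt {r : ℕ} (hr : r < n) (x : Fin r → ℝ) :
    ∫ y : Fin (n - r) → ℝ, symKernel j g (join x y) = 0 := by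
  have : NeZero (n - r) := ⟨(Nat.sub_pos_of_lt hr).ne'⟩
  have hint : ∀ σ : Equiv.Perm (Fin n), Integrable fun y : Fin (n - r) → ℝ =>
      ∏ i, onBlock (j (σ i)) (g (j (σ i))) (join x y i) := fun σ => by
    simp only [prod_join hr.le fun i => onBlock (j (σ i)) (g (j (σ i)))]
    exact (Integrable.fintype_prod fun i => integrable_onBlock hg _).const_mul _
  simp only [symKernel]
  rw [integral_finsetSum _ fun σ _ => hint σ]
  refine Finset.sum_eq_zero fun σ _ => ?_
  rw [integral_prod_join hr.le fun i => onBlock (j (σ i)) (g (j (σ i)))]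
  exact mul_eq_zero_of_right _ (Finset.prod_eq_zero (Finset.mem_univ 0)
    (integral_onBlock _ (hg _)))

/-- Integrating out any variable gives zero, so only the term `r = n` of `I_n` remains. -/
lemma multInt_symKernel (hj : Function.Injective j) :
    multInt n (symKernel j g) =ᵐ[P] fun ω => n.factorial * ∏ i, g (j i) (ω (j i)) := by
  filter_upwards [ae_forall_mem_Ico] with ω hω
  rw [multInt, Finset.sum_eq_single n]
  · have top_order : ∀ (k : Fin n ↪ ℕ) (y : Fin (n - n) → ℝ),
        mixedPoint ω k y = blockPoint k ω := fun k y => funext fun i => dif_pos i.2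
    have : IsEmpty (Fin (n - n)) := by rw [Nat.sub_self]; infer_instance
    simp [Measure.volume_pi_eq_dirac 0, top_order, (hasSum_symKernel_blockPoint hj hω).tsum_eq]
  · intro r hr hrn
    have hr' : r < n := lt_of_le_of_ne (Finset.mem_range_succ_iff.1 hr) hrn
    have lower_order : ∀ k : Fin r ↪ ℕ,
        ∫ y : Fin (n - r) → ℝ, symKernel j g (mixedPoint ω k y) = 0 := fun k =>
      integral_symKernel_join_of_lt hg hr' (blockPoint k ω)
    simp only [lower_order, tsum_zero, mul_zero]
  · simp

end SymKernel

lemma hoeffdingSpace_le_chaos (S : Finset ℕ) : hoeffdingSpace P unifs S ≤ chaos S.card := by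
  refine Submodule.topologicalClosure_minimal _ (Submodule.span_le.2 ?_)
    (Submodule.isClosed_topologicalClosure _)
  rintro Z ⟨g, hg, hZ⟩
  set j := S.orderEmbOfFin rfl
  have prod_eq : ∀ ω : Ω, ∏ i, g (j i) (ω (j i)) = coordProd S g ω := fun ω => by
    conv_rhs => rw [coordProd, ← Finset.image_orderEmbOfFin_univ S rfl]
    rw [Finset.prod_image fun a _ b _ h => j.injective h]
  have hmem : (S.card.factorial : ℝ) • Z ∈ chaos S.card := by
    refine Submodule.le_topologicalClosure _ (Submodule.subset_span
      ⟨symKernel j g, isKernel_symKernel hg j.injective, ?_⟩)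
    filter_upwards [multInt_symKernel hg j.injective, hZ,
      Lp.coeFn_smul (S.card.factorial : ℝ) Z] with ω hI hZω hsmul
    rw [hI, hsmul, Pi.smul_apply, hZω, smul_eq_mul, prod_eq]
  exact ((chaos S.card).smul_mem_iff (by positivity)).1 hmem

/-! ### Hoeffding spaces are orthogonal to the other chaoses -/

lemma sum_neg_one_pow_choose_descFactorial {n s : ℕ} (h : s ≠ n) :
    ∑ r ∈ Finset.range (n + 1), (-1 : ℝ) ^ (n - r) * n.choose r * r.descFactorial s = 0 := by
  have hdiff := fwdDiff_iter_choose_zero s n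
  rw [fwdDiff_iter_eq_sum_shift, if_neg h.symm] at hdiff
  have hcast := congrArg (fun z : ℤ => (s.factorial : ℝ) * z) hdiff
  simp only [smul_eq_mul, zero_add, mul_one, Int.cast_zero, mul_zero, Int.cast_sum,
    Finset.mul_sum] at hcast
  rw [← hcast]
  refine Finset.sum_congr rfl fun r _ => ?_
  rw [Nat.descFactorial_eq_factorial_mul_choose]
  push_cast
  ring

section Boxes

variable {r : ℕ}

lemma measurePreserving_join {n : ℕ} (hr : r ≤ n) :
    MeasurePreserving fun p : (Fin r → ℝ) × (Fin (n - r) → ℝ) => (join p.1 p.2 : Fin n → ℝ) := by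
  have join_eq : (fun p : (Fin r → ℝ) × (Fin (n - r) → ℝ) => (join p.1 p.2 : Fin n → ℝ)) =
      MeasurableEquiv.piCongrLeft (fun _ => ℝ) (finSplit hr) ∘
        (MeasurableEquiv.sumPiEquivProdPi fun _ => ℝ).symm := by
    refine funext fun p => funext fun i => ?_
    obtain ⟨i, rfl⟩ := (finSplit hr).surjective i
    rw [Function.comp_apply, MeasurableEquiv.coe_piCongrLeft, Equiv.piCongrLeft_apply_apply]
    rcases i with i | i
    · exact join_castLE hr _ _ i
    · exact join_finSplit_inr hr _ _ i
  rw [join_eq]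
  exact (volume_measurePreserving_piCongrLeft (fun _ => ℝ) (finSplit hr)).comp
    (volume_measurePreserving_sumPiEquivProdPi_symm fun _ => ℝ)

/-- The box of the half-open blocks of indices `k i`. -/
def box (k : Fin r → ℕ) : Set (Fin r → ℝ) := Set.univ.pi fun i => indexBlock (k i)

lemma measurableSet_box (k : Fin r → ℕ) : MeasurableSet (box k) :=
  .univ_pi fun _ => measurableSet_indexBlock _

lemma pairwise_disjoint_box :
    Pairwise (Function.onFun Disjoint fun k : Fin r ↪ ℕ => box k) := by
  intro k k' hkk
  refine Set.disjoint_left.2 fun x hx hx' => hkk ?_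
  ext i
  rw [← (mem_indexBlock_iff.1 (hx i trivial)).2, (mem_indexBlock_iff.1 (hx' i trivial)).2]

instance : Countable (Fin r ↪ ℕ) := DFunLike.coe_injective.countable

lemma hasSum_setIntegral_box {G : (Fin r → ℝ) → ℝ} (hG : Integrable G) :
    HasSum (fun k : Fin r ↪ ℕ => ∫ x in box k, G x) (∫ x in ⋃ k : Fin r ↪ ℕ, box k, G x) :=
  hasSum_integral_iUnion (fun k => measurableSet_box k) pairwise_disjoint_box hG.integrableOn

lemma measurable_blockPoint (k : Fin r → ℕ) : Measurable (blockPoint k) :=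
  measurable_pi_lambda _ fun i => (measurable_pi_apply (k i)).const_add _

lemma map_eval_comp (k : Fin r ↪ ℕ) :
    P.map (fun ω i => ω (k i)) = Measure.pi fun _ : Fin r => unif := by
  rw [P, Measure.map_infinitePi_infinitePi_of_inj k.injective, Measure.infinitePi_eq_pi]

lemma map_blockPoint (k : Fin r ↪ ℕ) :
    P.map (blockPoint k) = ((2 : ℝ≥0∞)⁻¹ ^ r) • volume.restrict (box k) := by
  have hshift : ∀ i, Measurable fun u : ℝ => 2 * (k i : ℝ) + 1 + u := fun i =>
    (measurableEmbedding_shift (k i)).measurable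
  have : ∀ i, IsProbabilityMeasure (unif.map fun u => 2 * (k i : ℝ) + 1 + u) := fun i =>
    Measure.isProbabilityMeasure_map (hshift i).aemeasurable
  have hcomp : P.map (blockPoint k) =
      (P.map fun ω i => ω (k i)).map fun (x : Fin r → ℝ) i => 2 * (k i : ℝ) + 1 + x i :=
    (Measure.map_map (g := fun (x : Fin r → ℝ) i => 2 * (k i : ℝ) + 1 + x i)
      (f := fun (ω : Ω) i => ω (k i))
      (measurable_pi_lambda _ fun i => (hshift i).comp (measurable_pi_apply i))
      (measurable_pi_lambda _ fun i => measurable_pi_apply _)).symm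
  rw [hcomp, map_eval_comp,
    Measure.pi_map_pi (f := fun i u => 2 * (k i : ℝ) + 1 + u) fun i => (hshift i).aemeasurable]
  refine Measure.pi_eq fun s hs => ?_
  rw [Measure.smul_apply, Measure.restrict_apply (.univ_pi hs), box, ← Set.pi_inter_distrib,
    volume_pi_pi]
  simp_rw [map_shift_unif, Measure.smul_apply, smul_eq_mul, Finset.prod_mul_distrib,
    Finset.prod_const, Finset.card_univ, Fintype.card_fin, Measure.restrict_apply (hs _)]

lemma integral_comp_blockPoint (k : Fin r ↪ ℕ) {F : (Fin r → ℝ) → ℝ}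
    (hF : AEStronglyMeasurable F) :
    ∫ ω, F (blockPoint k ω) ∂P = (2⁻¹ : ℝ) ^ r * ∫ x in box k, F x := by
  have hF' : AEStronglyMeasurable F (P.map (blockPoint k)) := by
    rw [map_blockPoint]
    exact hF.restrict.smul_measure _
  rw [← integral_map (measurable_blockPoint k).aemeasurable hF', map_blockPoint,
    integral_smul_measure]
  simp

lemma integrable_comp_blockPoint (k : Fin r ↪ ℕ) {F : (Fin r → ℝ) → ℝ} (hF : Integrable F) :
    Integrable (fun ω => F (blockPoint k ω)) P := by
  have hF' : Integrable F (P.map (blockPoint k)) := by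
    rw [map_blockPoint]
    exact hF.restrict.smul_measure (by simp)
  exact hF'.comp_measurable (measurable_blockPoint k)

lemma summable_integral_norm_comp_blockPoint {F : (Fin r → ℝ) → ℝ} (hF : Integrable F) :
    Summable fun k : Fin r ↪ ℕ => ∫ ω, ‖F (blockPoint k ω)‖ ∂P := by
  simp_rw [integral_comp_blockPoint _ hF.norm.aestronglyMeasurable]
  exact (hasSum_setIntegral_box hF.norm).summable.mul_left _

end Boxes

/-- The product over `j ∈ S` of the sums of the values of `g j` at the points of `x` in the block
of index `j`; it turns into `coordProd S g` at the random points `blockPoint k ω`. -/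
def blockProd (S : Finset ℕ) (g : ℕ → ℝ → ℝ) {r : ℕ} (x : Fin r → ℝ) : ℝ :=
  ∏ j ∈ S, ∑ i, onBlock j (g j) (x i)

section BlockProd

variable {S : Finset ℕ} {g : ℕ → ℝ → ℝ} {r : ℕ} {ω : Ω}

lemma blockProd_blockPoint (k : Fin r ↪ ℕ) (hω : ∀ k : ℕ, ω k ∈ Set.Ico (-1 : ℝ) 1) :
    blockProd S g (blockPoint k ω) = ∏ j ∈ S, ∑ i, if j = k i then g j (ω (k i)) else 0 := by
  simp only [blockProd, blockPoint, onBlock_shift (hω _)]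

lemma blockProd_blockPoint_eq_coordProd {k : Fin r ↪ ℕ} (hS : ∀ j ∈ S, ∃ i, k i = j)
    (hω : ∀ k : ℕ, ω k ∈ Set.Ico (-1 : ℝ) 1) :
    blockProd S g (blockPoint k ω) = coordProd S g ω := by
  rw [blockProd_blockPoint k hω, coordProd]
  refine Finset.prod_congr rfl fun j hj => ?_
  obtain ⟨i, rfl⟩ := hS j hj
  simp

lemma blockProd_blockPoint_eq_zero {k : Fin r ↪ ℕ} {j : ℕ} (hj : j ∈ S) (hk : ∀ i, k i ≠ j)
    (hω : ∀ k : ℕ, ω k ∈ Set.Ico (-1 : ℝ) 1) : blockProd S g (blockPoint k ω) = 0 := by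
  rw [blockProd_blockPoint k hω]
  exact Finset.prod_eq_zero hj (Finset.sum_eq_zero fun i _ => if_neg fun h => hk i h.symm)

variable (hg : ∀ k, IsCenteredBounded unif (g k))

include hg

lemma measurable_blockProd : Measurable (blockProd S g (r := r)) :=
  Finset.measurable_fun_prod _ fun j _ => Finset.measurable_fun_sum _ fun i _ =>
    (measurable_onBlock j (hg j).measurable).comp (measurable_pi_apply i)

lemma exists_abs_blockProd_le : ∃ C, ∀ x : Fin r → ℝ, |blockProd S g x| ≤ C := by
  choose C hC using fun k => (hg k).bounded
  refine ⟨∏ j ∈ S, ∑ _i : Fin r, C j, fun x => ?_⟩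
  rw [blockProd, Finset.abs_prod]
  exact Finset.prod_le_prod (fun k _ => abs_nonneg _) fun j _ =>
    (Finset.abs_sum_le_sum_abs _ _).trans
      (Finset.sum_le_sum fun i _ => abs_onBlock_le j (hC j) _)

lemma integrable_mul_blockProd {F : (Fin r → ℝ) → ℝ} (hF : Integrable F) :
    Integrable fun x => F x * blockProd S g x := by
  obtain ⟨C, hC⟩ := exists_abs_blockProd_le (S := S) hg (r := r)
  exact hF.mul_bdd (c := C) (measurable_blockProd hg).aestronglyMeasurable (ae_of_all _ hC)

/-- If `j ∈ S` is not among the `k i`, then the left-hand side vanishes after integration over the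
coordinate `j`, and the right-hand side does because no point of the box lies in block `j`. -/
lemma integral_comp_blockPoint_mul_coordProd (k : Fin r ↪ ℕ) {F : (Fin r → ℝ) → ℝ}
    (hF : Integrable F) :
    ∫ ω, F (blockPoint k ω) * coordProd S g ω ∂P =
      (2⁻¹ : ℝ) ^ r * ∫ x in box k, F x * blockProd S g x := by
  rw [← integral_comp_blockPoint k (integrable_mul_blockProd hg hF).aestronglyMeasurable]
  by_cases hS : ∀ j ∈ S, ∃ i, k i = j
  · refine integral_congr_ae ?_
    filter_upwards [ae_forall_mem_Ico] with ω hω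
    rw [blockProd_blockPoint_eq_coordProd hS hω]
  · push Not at hS
    obtain ⟨j, hj, hk⟩ := hS
    have right_eq_zero : ∫ ω, F (blockPoint k ω) * blockProd S g (blockPoint k ω) ∂P = 0 := by
      refine integral_eq_zero_of_ae ?_
      filter_upwards [ae_forall_mem_Ico] with ω hω
      rw [blockProd_blockPoint_eq_zero hj hk hω, mul_zero, Pi.zero_apply]
    have point_update : ∀ (ω : Ω) (u : ℝ), blockPoint k (update ω j u) = blockPoint k ω :=
      fun ω u => funext fun i => by rw [blockPoint, Function.update_of_ne (hk i), blockPoint]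
    rw [right_eq_zero]
    refine integral_eq_zero_of_update_eq_mul (μ := unifs) j (g := g j)
      (R := fun ω => F (blockPoint k ω) * coordProd (S.erase j) g ω)
      (integrable_mul_coordProd S hg (integrable_comp_blockPoint k hF)) (hg j).integral_eq_zero
      fun ω u => ?_
    rw [point_update, coordProd_update_of_mem hj]
    ring

lemma summable_integral_norm_comp_blockPoint_mul_coordProd {F : (Fin r → ℝ) → ℝ}
    (hF : Integrable F) :
    Summable fun k : Fin r ↪ ℕ => ∫ ω, ‖F (blockPoint k ω) * coordProd S g ω‖ ∂P := by
  obtain ⟨C, hC⟩ := exists_abs_coordProd_le S hg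
  refine .of_nonneg_of_le (fun k => integral_nonneg fun ω => norm_nonneg _) (fun k => ?_)
    ((summable_integral_norm_comp_blockPoint hF).mul_right C)
  rw [← integral_mul_const]
  refine integral_mono (integrable_mul_coordProd S hg (integrable_comp_blockPoint k hF)).norm
    ((integrable_comp_blockPoint k hF).norm.mul_const C) fun ω => ?_
  exact (norm_mul _ _).trans_le (mul_le_mul_of_nonneg_left (hC ω) (norm_nonneg _))

lemma integrable_tsum_comp_blockPoint_mul_coordProd {F : (Fin r → ℝ) → ℝ} (hF : Integrable F) :
    Integrable (fun ω => (∑' k : Fin r ↪ ℕ, F (blockPoint k ω)) * coordProd S g ω) P := by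
  have hint : ∀ k : Fin r ↪ ℕ, Integrable (fun ω => F (blockPoint k ω) * coordProd S g ω) P :=
    fun k => integrable_mul_coordProd S hg (integrable_comp_blockPoint k hF)
  simp_rw [← tsum_mul_right]
  refine integrable_tsum_of_tsum_lintegral_enorm_ne_top (fun k => (hint k).aestronglyMeasurable) ?_
  simp_rw [← ofReal_integral_norm_eq_lintegral_enorm (hint _)]
  exact (summable_integral_norm_comp_blockPoint_mul_coordProd hg hF).tsum_ofReal_ne_top

lemma integral_tsum_comp_blockPoint_mul_coordProd {F : (Fin r → ℝ) → ℝ} (hF : Integrable F) :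
    ∫ ω, (∑' k : Fin r ↪ ℕ, F (blockPoint k ω)) * coordProd S g ω ∂P =
      (2⁻¹ : ℝ) ^ r * ∫ x in ⋃ k : Fin r ↪ ℕ, box k, F x * blockProd S g x := by
  simp_rw [← tsum_mul_right]
  rw [← (hasSum_integral_of_summable_integral_norm
    (fun k => integrable_mul_coordProd S hg (integrable_comp_blockPoint k hF))
    (summable_integral_norm_comp_blockPoint_mul_coordProd hg hF)).tsum_eq]
  simp_rw [integral_comp_blockPoint_mul_coordProd hg _ hF]
  rw [tsum_mul_left, (hasSum_setIntegral_box (integrable_mul_blockProd hg hF)).tsum_eq]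

end BlockProd

/-- The integral of `f` over all but its first `r` variables. -/
def partialIntegral {n : ℕ} (f : (Fin n → ℝ) → ℝ) (r : ℕ) (x : Fin r → ℝ) : ℝ :=
  ∫ y : Fin (n - r) → ℝ, f (join x y)

section PartialIntegral

variable {n : ℕ} {f : (Fin n → ℝ) → ℝ} {r : ℕ}

lemma integrable_partialIntegral (hf : Integrable f) (hr : r ≤ n) :
    Integrable (partialIntegral f r) :=
  ((measurePreserving_join hr).integrable_comp_of_integrable hf).integral_prod_left

lemma ae_partialIntegral_eq_zero (hf : IsKernel n f) (hr : r ≤ n) :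
    ∀ᵐ x : Fin r → ℝ, x ∉ ⋃ k : Fin r ↪ ℕ, box k → partialIntegral f r x = 0 := by
  have off_endpoints : ∀ᵐ x : Fin r → ℝ, ∀ (i : Fin r) (m : ℕ), x i ≠ 2 * (m : ℝ) + 2 :=
    ae_all_iff.2 fun i => ae_all_iff.2 fun m => Measure.ae_eval_ne _ i _
  filter_upwards [off_endpoints] with x hx hxb
  have join_zero : ∀ y : Fin (n - r) → ℝ, f (join x y) = 0 := fun y => by
    refine hf.zero_off _ fun hD => hxb ?_
    obtain ⟨K, hK⟩ := Set.mem_iUnion.1 hD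
    refine Set.mem_iUnion.2 ⟨(Fin.castLEEmb hr).trans K, fun i _ => ?_⟩
    have hi := hK (Fin.castLE hr i) trivial
    rw [join_castLE] at hi
    exact ⟨hi.1, lt_of_le_of_ne hi.2 (hx i _)⟩
  simp [partialIntegral, join_zero]

variable {S : Finset ℕ} {g : ℕ → ℝ → ℝ} (hg : ∀ k, IsCenteredBounded unif (g k))

include hg

lemma integral_partialIntegral_mul_blockProd (hf : Integrable f) (hr : r ≤ n) :
    ∫ x : Fin r → ℝ, partialIntegral f r x * blockProd S g x =
      ∫ z, f z * blockProd S g fun i : Fin r => z (Fin.castLE hr i) := by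
  obtain ⟨C, hC⟩ := exists_abs_blockProd_le (S := S) hg (r := r)
  have hm : Measurable fun z : Fin n → ℝ => blockProd S g fun i : Fin r => z (Fin.castLE hr i) :=
    (measurable_blockProd hg).comp (measurable_pi_lambda _ fun i => measurable_pi_apply _)
  have hint : Integrable fun z : Fin n → ℝ =>
      f z * blockProd S g fun i : Fin r => z (Fin.castLE hr i) :=
    hf.mul_bdd (c := C) hm.aestronglyMeasurable (ae_of_all _ fun z => hC _)
  have hjoin := measurePreserving_join hr
  calc ∫ x : Fin r → ℝ, partialIntegral f r x * blockProd S g x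
    _ = ∫ x : Fin r → ℝ, ∫ y : Fin (n - r) → ℝ, f (join x y) *
          blockProd S g fun i : Fin r => join x y (Fin.castLE hr i) := by
      simp only [join_castLE hr, integral_mul_const, partialIntegral]
    _ = ∫ p : (Fin r → ℝ) × (Fin (n - r) → ℝ), f (join p.1 p.2) *
          blockProd S g fun i : Fin r => join p.1 p.2 (Fin.castLE hr i) :=
      (integral_prod _ (hjoin.integrable_comp_of_integrable hint)).symm
    _ = _ := by
      rw [← hjoin.map_eq] at hint ⊢
      rw [integral_map hjoin.measurable.aemeasurable hint.aestronglyMeasurable]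

lemma integral_tsum_partialIntegral_mul_coordProd (hf : IsKernel n f) (hr : r ≤ n) :
    ∫ ω, (∑' k : Fin r ↪ ℕ, partialIntegral f r (blockPoint k ω)) * coordProd S g ω ∂P =
      (2⁻¹ : ℝ) ^ r * ∫ z, f z * blockProd S g fun i : Fin r => z (Fin.castLE hr i) := by
  rw [integral_tsum_comp_blockPoint_mul_coordProd hg
    (integrable_partialIntegral hf.integrable hr),
    ← integral_partialIntegral_mul_blockProd hg hf.integrable hr]
  congr 1
  refine setIntegral_eq_integral_of_ae_compl_eq_zero ?_
  filter_upwards [ae_partialIntegral_eq_zero hf hr] with x hx hxb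
  rw [hx hxb, zero_mul]

end PartialIntegral

section Symmetry

variable {n : ℕ} {f : (Fin n → ℝ) → ℝ} {S : Finset ℕ} {g : ℕ → ℝ → ℝ}

lemma integral_comp_perm (σ : Equiv.Perm (Fin n)) (F : (Fin n → ℝ) → ℝ) :
    ∫ z : Fin n → ℝ, F (z ∘ σ) = ∫ z, F z :=
  (volume_preserving_arrowCongr' σ.symm (.refl ℝ) (.id _)).integral_comp' F

lemma integral_mul_prod_onBlock_eq (hf : IsKernel n f) {p q : S → Fin n}
    (hp : Function.Injective p) (hq : Function.Injective q) :
    ∫ z, f z * ∏ j : S, onBlock j (g j) (z (p j)) =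
      ∫ z, f z * ∏ j : S, onBlock j (g j) (z (q j)) := by
  obtain ⟨σ, hσ⟩ := Equiv.Perm.exists_extending_pair q p hq hp
  rw [← integral_comp_perm σ fun z => f z * ∏ j : S, onBlock j (g j) (z (q j))]
  simp only [Function.comp_apply, hσ, hf.symm]

lemma prod_onBlock_eq_zero {p : S → Fin n} (hp : ¬ Function.Injective p) (z : Fin n → ℝ) :
    ∏ j : S, onBlock j (g j) (z (p j)) = 0 := by
  obtain ⟨a, b, hab, hne⟩ := Function.not_injective_iff.1 hp
  by_cases h : z (p a) ∈ indexBlock a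
  · refine Finset.prod_eq_zero (Finset.mem_univ b) (onBlock_of_notMem (fun h' => hne ?_) _)
    rw [← hab] at h'
    exact Subtype.ext ((mem_indexBlock_iff.1 h).2.symm.trans (mem_indexBlock_iff.1 h').2)
  · exact Finset.prod_eq_zero (Finset.mem_univ a) (onBlock_of_notMem h _)

lemma exists_integral_mul_prod_onBlock_eq_ite (hf : IsKernel n f) :
    ∃ A : ℝ, ∀ p : S → Fin n, ∫ z, f z * ∏ j : S, onBlock j (g j) (z (p j)) =
      if Function.Injective p then A else 0 := by
  have eq_zero : ∀ p : S → Fin n, ¬ Function.Injective p →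
      ∫ z, f z * ∏ j : S, onBlock j (g j) (z (p j)) = 0 := fun p hp => by
    simp only [prod_onBlock_eq_zero hp, mul_zero, integral_zero]
  by_cases h : ∃ q : S → Fin n, Function.Injective q
  · obtain ⟨q, hq⟩ := h
    refine ⟨∫ z, f z * ∏ j : S, onBlock j (g j) (z (q j)), fun p => ?_⟩
    split_ifs with hp
    · exact integral_mul_prod_onBlock_eq hf hp hq
    · exact eq_zero p hp
  · push Not at h
    exact ⟨0, fun p => by rw [eq_zero p (h p), if_neg (h p)]⟩

lemma card_filter_injective {α : Type*} [Fintype α] [DecidableEq α] (r : ℕ) :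
    (Finset.univ.filter fun p : α → Fin r => Function.Injective p).card =
      r.descFactorial (Fintype.card α) := by
  rw [← Fintype.card_subtype, Fintype.card_congr (Equiv.subtypeInjectiveEquivEmbedding α (Fin r)),
    Fintype.card_embedding_eq, Fintype.card_fin]

lemma blockProd_eq_sum_prod_onBlock {r : ℕ} (x : Fin r → ℝ) :
    blockProd S g x = ∑ p : S → Fin r, ∏ j : S, onBlock j (g j) (x (p j)) := by
  rw [blockProd, ← Finset.prod_coe_sort S, Finset.prod_univ_sum, Fintype.piFinset_univ]

variable (hg : ∀ k, IsCenteredBounded unif (g k))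

include hg

lemma integrable_mul_prod_onBlock (hf : Integrable f) (p : S → Fin n) :
    Integrable fun z => f z * ∏ j : S, onBlock j (g j) (z (p j)) := by
  choose C hC using fun k => (hg k).bounded
  have hm : Measurable fun z : Fin n → ℝ => ∏ j : S, onBlock j (g j) (z (p j)) :=
    Finset.measurable_fun_prod _ fun j _ => (measurable_onBlock j (hg j).measurable).comp
      (measurable_pi_apply (p j))
  refine hf.mul_bdd (c := ∏ j : S, C j) hm.aestronglyMeasurable (ae_of_all _ fun z => ?_)
  rw [Real.norm_eq_abs, Finset.abs_prod]
  exact Finset.prod_le_prod (fun _ _ => abs_nonneg _) fun j _ => abs_onBlock_le j (hC j) _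

/-- By symmetry of `f`, all the injective assignments of variables to the elements of `S`
contribute the same amount. -/
lemma exists_integral_mul_blockProd_eq (hf : IsKernel n f) :
    ∃ A : ℝ, ∀ (r : ℕ) (hr : r ≤ n),
      ∫ z, f z * blockProd S g (fun i : Fin r => z (Fin.castLE hr i)) =
        r.descFactorial S.card * A := by
  obtain ⟨A, hA⟩ := exists_integral_mul_prod_onBlock_eq_ite (S := S) (g := g) hf
  refine ⟨A, fun r hr => ?_⟩
  simp_rw [blockProd_eq_sum_prod_onBlock, Finset.mul_sum]
  rw [integral_finsetSum _ fun p _ =>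
    integrable_mul_prod_onBlock hg hf.integrable fun j => Fin.castLE hr (p j)]
  have eq_ite : ∀ p : S → Fin r,
      ∫ z, f z * ∏ j : S, onBlock j (g j) (z (Fin.castLE hr (p j))) =
        if Function.Injective p then A else 0 := fun p =>
    (hA fun j => Fin.castLE hr (p j)).trans
      (if_congr ((Fin.castLE_injective hr).of_comp_iff p) rfl rfl)
  simp_rw [eq_ite]
  rw [← Finset.sum_filter, Finset.sum_const, card_filter_injective, Fintype.card_coe,
    nsmul_eq_mul]

lemma integral_multInt_mul_coordProd (hf : IsKernel n f) (hS : S.card ≠ n) :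
    ∫ ω, multInt n f ω * coordProd S g ω ∂P = 0 := by
  obtain ⟨A, hA⟩ := exists_integral_mul_blockProd_eq (S := S) hg hf
  have expand : ∀ ω, multInt n f ω * coordProd S g ω = ∑ r ∈ Finset.range (n + 1),
      (-1 : ℝ) ^ (n - r) / 2 ^ (n - r) * n.choose r *
        ((∑' k : Fin r ↪ ℕ, partialIntegral f r (blockPoint k ω)) * coordProd S g ω) :=
    fun ω => by
      rw [multInt, Finset.sum_mul]
      exact Finset.sum_congr rfl fun r _ => mul_assoc _ _ _
  have term_eq : ∀ r ∈ Finset.range (n + 1), ∫ ω, (-1 : ℝ) ^ (n - r) / 2 ^ (n - r) * n.choose r *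
      ((∑' k : Fin r ↪ ℕ, partialIntegral f r (blockPoint k ω)) * coordProd S g ω) ∂P =
      2⁻¹ ^ n * A * ((-1) ^ (n - r) * n.choose r * r.descFactorial S.card) := fun r hr => by
    have hr' : r ≤ n := Finset.mem_range_succ_iff.1 hr
    have hpow : (2⁻¹ : ℝ) ^ n = 2⁻¹ ^ r / 2 ^ (n - r) := by
      rw [div_eq_mul_inv, ← inv_pow, ← pow_add, Nat.add_sub_cancel' hr']
    rw [integral_const_mul, integral_tsum_partialIntegral_mul_coordProd hg hf hr', hA r hr', hpow]
    ring
  simp_rw [expand]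
  rw [integral_finsetSum _ fun r hr => (integrable_tsum_comp_blockPoint_mul_coordProd hg
      (integrable_partialIntegral hf.integrable (Finset.mem_range_succ_iff.1 hr))).const_mul _,
    Finset.sum_congr rfl term_eq, ← Finset.mul_sum, sum_neg_one_pow_choose_descFactorial hS,
    mul_zero]

end Symmetry

lemma hoeffdingSpace_isOrtho_chaos {S : Finset ℕ} {n : ℕ} (hS : S.card ≠ n) :
    hoeffdingSpace P unifs S ⟂ chaos n := by
  refine isOrtho_topologicalClosure_span ?_
  rintro Y ⟨g, hg, hY⟩ Z ⟨f, hf, hZ⟩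
  rw [real_inner_comm, inner_eq_integral_mul hZ hY]
  exact integral_multInt_mul_coordProd hg hf hS

/-! ### The inverse of the Ornstein-Uhlenbeck operator -/

lemma starProjection_hoeffdingSpace_starProjection_chaos (S : Finset ℕ) (n : ℕ) (X : Lp ℝ 2 P) :
    (hoeffdingSpace P unifs S).starProjection ((chaos n).starProjection X) =
      if S.card = n then (hoeffdingSpace P unifs S).starProjection X else 0 := by
  split_ifs with h
  · subst h
    exact DFunLike.congr_fun
      (Submodule.starProjection_comp_starProjection_of_le (hoeffdingSpace_le_chaos S)) X
  · exact DFunLike.congr_fun (hoeffdingSpace_isOrtho_chaos h).starProjection_comp_starProjection X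

lemma pairwise_isOrtho_chaos : Pairwise (chaos · ⟂ chaos ·) := by
  intro m n hmn
  rw [← Submodule.starProjection_comp_starProjection_eq_zero_iff]
  ext1 X
  refine (hasSum_starProjection (pairwise_isOrtho_hoeffdingSpace (μ := unifs))
    topologicalClosure_iSup_hoeffdingSpace _).unique ?_
  rw [zero_apply]
  convert hasSum_zero with S
  rw [ContinuousLinearMap.comp_apply, starProjection_hoeffdingSpace_starProjection_chaos]
  split_ifs with h
  · rw [starProjection_hoeffdingSpace_starProjection_chaos, if_neg (h ▸ hmn)]
  · rfl

lemma summable_smul_starProjection_chaos (X : Lp ℝ 2 P) :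
    Summable fun n : ℕ => (1 / ((n : ℝ) + 1)) • (chaos (n + 1)).starProjection X := by
  refine summable_smul_starProjection (fun m n hmn => pairwise_isOrtho_chaos (by simpa using hmn))
    (C := 1) (fun n => ?_) X
  rw [abs_of_pos (by positivity), div_le_one (by positivity)]
  exact le_add_of_nonneg_left n.cast_nonneg

lemma starProjection_hoeffdingSpace_Linv (S : Finset ℕ) (X : Lp ℝ 2 P) :
    (hoeffdingSpace P unifs S).starProjection (Linv X) =
      -((S.card : ℝ)⁻¹ • (hoeffdingSpace P unifs S).starProjection X) := by
  rw [Linv, map_neg, ContinuousLinearMap.map_tsum _ (summable_smul_starProjection_chaos X)]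
  simp_rw [map_smul, starProjection_hoeffdingSpace_starProjection_chaos]
  cases S.card with
  | zero => simp
  | succ m =>
    rw [tsum_eq_single m fun n hn => by rw [if_neg (by omega), smul_zero], if_pos rfl, one_div,
      Nat.cast_add_one]

lemma isOrnsteinUhlenbeckSolution_Linv {X : Lp ℝ 2 P} (hX : ∫ ω, X ω ∂P = 0) :
    IsOrnsteinUhlenbeckSolution unifs (Linv X) X := by
  intro S
  rcases S.eq_empty_or_nonempty with rfl | h
  · simp [starProjection_hoeffdingSpace_empty_eq_zero hX]
  · have hcard : (S.card : ℝ) ≠ 0 := by exact_mod_cast h.card_pos.ne'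
    rw [starProjection_hoeffdingSpace_Linv, smul_neg, smul_smul, mul_inv_cancel₀ hcard, one_smul]

/-! ### From the half-line to coordinates -/

section Nabla

variable {x w : Ω → ℝ}

lemma setLIntegral_Ici_nabla (ω : Ω) (F : ℝ≥0∞ → ℝ≥0∞ → ℝ≥0∞) :
    ∫⁻ t in Set.Ici (0 : ℝ), F ‖nabla t x ω‖ₑ ‖nabla t w ω‖ₑ =
      ∑' k : ℕ, 2 * ∫⁻ u, F ‖coordDiff unifs k x (update ω k u)‖ₑ
        ‖coordDiff unifs k w (update ω k u)‖ₑ ∂unif := by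
  rw [setLIntegral_Ici_eq_tsum]
  refine tsum_congr fun k => congrArg (2 * ·) (lintegral_congr_ae ?_)
  filter_upwards [ae_unif_mem_Ico] with u hu
  rw [nabla_shift k hu, nabla_shift k hu]

lemma lintegral_setLIntegral_Ici_nabla (hmx : Measurable x) (hmw : Measurable w)
    {F : ℝ≥0∞ → ℝ≥0∞ → ℝ≥0∞} (hF : Measurable (Function.uncurry F)) :
    ∫⁻ ω, (∫⁻ t in Set.Ici (0 : ℝ), F ‖nabla t x ω‖ₑ ‖nabla t w ω‖ₑ) ∂P =
      2 * ∑' k : ℕ, ∫⁻ ω, F ‖coordDiff unifs k x ω‖ₑ ‖coordDiff unifs k w ω‖ₑ ∂P := by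
  have hm : ∀ k, Measurable fun ω => F ‖coordDiff unifs k x ω‖ₑ ‖coordDiff unifs k w ω‖ₑ :=
    fun k => hF.comp ((measurable_coordDiff unifs k hmx).enorm.prodMk
      (measurable_coordDiff unifs k hmw).enorm)
  have hm' : ∀ k, Measurable fun ω => ∫⁻ u, F ‖coordDiff unifs k x (update ω k u)‖ₑ
      ‖coordDiff unifs k w (update ω k u)‖ₑ ∂unif :=
    fun k => ((hm k).comp measurable_update').lintegral_prod_right'
  simp_rw [setLIntegral_Ici_nabla, ENNReal.tsum_mul_left]
  rw [lintegral_const_mul _ (Measurable.tsum hm'),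
    lintegral_tsum fun k => (hm' k).aemeasurable]
  exact congrArg (2 * ·) (tsum_congr fun k => lintegral_lintegral_update unifs k (hm k))

lemma tsum_lintegral_enorm_sq_coordDiff_lt_top {X : Lp ℝ 2 P} (hX : X ∈ DomNabla) :
    ∑' k : ℕ, ∫⁻ ω, ‖coordDiff unifs k X ω‖ₑ ^ 2 ∂P < ∞ := by
  have hm : Measurable X := (Lp.stronglyMeasurable X).measurable
  have h : ∫⁻ ω, (∫⁻ t in Set.Ici (0 : ℝ), ‖nabla t X ω‖ₑ ^ 2) ∂P < ∞ := hX
  rw [lintegral_setLIntegral_Ici_nabla (F := fun a _ => a ^ 2) hm hm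
    (measurable_fst.pow_const 2)] at h
  exact ENNReal.lt_top_of_mul_ne_top_right h.ne two_ne_zero

lemma ae_integrableOn_nabla_mul (hmx : Measurable x) (hmw : Measurable w)
    (h : ∑' k : ℕ, ∫⁻ ω, ‖coordDiff unifs k x ω‖ₑ * ‖coordDiff unifs k w ω‖ₑ ∂P < ∞) :
    ∀ᵐ ω ∂P, IntegrableOn (fun t : ℝ => nabla t x ω * -nabla t w ω) (Set.Ici 0) := by
  have hm : Measurable fun p : ℝ × Ω => nabla p.1 x p.2 * -nabla p.1 w p.2 :=
    (measurable_nabla hmx).mul (measurable_nabla hmw).neg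
  have lintegral_lt_top :
      ∀ᵐ ω ∂P, ∫⁻ t in Set.Ici (0 : ℝ), ‖nabla t x ω * -nabla t w ω‖ₑ < ∞ := by
    refine ae_lt_top (hm.comp measurable_swap).enorm.lintegral_prod_right' ?_
    simp_rw [enorm_mul, enorm_neg]
    rw [lintegral_setLIntegral_Ici_nabla (F := fun a b => a * b) hmx hmw measurable_mul]
    exact ENNReal.mul_ne_top ENNReal.ofNat_ne_top h.ne
  filter_upwards [lintegral_lt_top] with ω hω
  exact ⟨(hm.comp measurable_prodMk_right).aestronglyMeasurable, hω⟩

lemma half_setIntegral_nabla_mul {ω : Ω}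
    (h : IntegrableOn (fun t : ℝ => nabla t x ω * -nabla t w ω) (Set.Ici 0)) :
    1 / 2 * ∫ t in Set.Ici (0 : ℝ), nabla t x ω * -nabla t w ω =
      -∑' k, coordCov unifs k x w ω := by
  have integral_eq : ∀ k : ℕ, ∫ u, nabla (2 * (k : ℝ) + 1 + u) x ω *
      -nabla (2 * (k : ℝ) + 1 + u) w ω ∂unif = -coordCov unifs k x w ω := fun k => by
    rw [coordCov, ← integral_neg]
    refine integral_congr_ae ?_
    filter_upwards [ae_unif_mem_Ico] with u hu
    rw [nabla_shift k hu, nabla_shift k hu, mul_neg]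
  rw [← (hasSum_setIntegral_Ici h).tsum_eq, tsum_mul_left, ← mul_assoc]
  simp_rw [integral_eq, tsum_neg]
  norm_num

lemma setLIntegral_block_shift_nabla (k : ℕ) {u : ℝ} (hu : u ∈ Set.Ico (-1 : ℝ) 1) (ω : Ω) :
    ∫⁻ s in block (2 * (k : ℝ) + 1 + u), ‖nabla s x ω‖ₑ ^ 2 =
      2 * ∫⁻ v, ‖coordDiff unifs k x (update ω k v)‖ₑ ^ 2 ∂unif := by
  rw [block_shift k hu, setLIntegral_indexBlock]
  refine congrArg (2 * ·) (lintegral_congr_ae ?_)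
  filter_upwards [ae_unif_mem_Ico] with v hv
  rw [nabla_shift k hv]

lemma setLIntegral_Ici_nabla_mul_setLIntegral_block (ω : Ω) :
    ∫⁻ t in Set.Ici (0 : ℝ), ‖nabla t w ω‖ₑ * ∫⁻ s in block t, ‖nabla s x ω‖ₑ ^ 2 =
      4 * ∑' k : ℕ, ∫⁻ u, ‖coordDiff unifs k w (update ω k u)‖ₑ *
        ∫⁻ v, ‖coordDiff unifs k x (update ω k v)‖ₑ ^ 2 ∂unif ∂unif := by
  have block_eq : ∀ k : ℕ, ∫⁻ u, ‖nabla (2 * (k : ℝ) + 1 + u) w ω‖ₑ *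
      (∫⁻ s in block (2 * (k : ℝ) + 1 + u), ‖nabla s x ω‖ₑ ^ 2) ∂unif =
        2 * ∫⁻ u, ‖coordDiff unifs k w (update ω k u)‖ₑ *
          ∫⁻ v, ‖coordDiff unifs k x (update ω k v)‖ₑ ^ 2 ∂unif ∂unif := fun k => by
    rw [← lintegral_const_mul' _ _ ENNReal.ofNat_ne_top]
    refine lintegral_congr_ae ?_
    filter_upwards [ae_unif_mem_Ico] with u hu
    rw [nabla_shift k hu, setLIntegral_block_shift_nabla k hu, mul_left_comm]
  rw [setLIntegral_Ici_eq_tsum]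
  simp_rw [block_eq, ENNReal.tsum_mul_left, ← mul_assoc]
  norm_num

lemma lintegral_setLIntegral_Ici_nabla_mul_setLIntegral_block (hmx : Measurable x)
    (hmw : Measurable w) :
    ∫⁻ ω, (∫⁻ t in Set.Ici (0 : ℝ), ‖nabla t w ω‖ₑ * ∫⁻ s in block t, ‖nabla s x ω‖ₑ ^ 2) ∂P =
      4 * ∑' k : ℕ, ∫⁻ ω, (∫⁻ u, ‖coordDiff unifs k w (update ω k u)‖ₑ *
        ∫⁻ v, ‖coordDiff unifs k x (update ω k v)‖ₑ ^ 2 ∂unif ∂unif) ∂P := by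
  have inner_measurable : ∀ k : ℕ, Measurable fun ω =>
      ∫⁻ v, ‖coordDiff unifs k x (update ω k v)‖ₑ ^ 2 ∂unif := fun k =>
    (((measurable_coordDiff unifs k hmx).comp measurable_update').enorm.pow_const
      2).lintegral_prod_right'
  have hm : ∀ k : ℕ, Measurable fun ω => ∫⁻ u, ‖coordDiff unifs k w (update ω k u)‖ₑ *
      ∫⁻ v, ‖coordDiff unifs k x (update ω k v)‖ₑ ^ 2 ∂unif ∂unif := fun k =>
    (((measurable_coordDiff unifs k hmw).comp measurable_update').enorm.mul
      ((inner_measurable k).comp measurable_fst)).lintegral_prod_right'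
  simp_rw [setLIntegral_Ici_nabla_mul_setLIntegral_block]
  rw [lintegral_const_mul _ (Measurable.tsum hm),
    lintegral_tsum fun k => (hm k).aemeasurable]

lemma tsum_coordRemainder (hmx : Measurable x) (hx : MemLp x 2 P) (hmw : Measurable w) :
    ∑' k, coordRemainder P unifs k x w =
      1 / 2 * (∫⁻ ω, (∫⁻ t in Set.Ici (0 : ℝ), ‖nabla t w ω‖ₑ * ‖nabla t x ω‖ₑ ^ 2) ∂P) +
        1 / 4 * (∫⁻ ω, (∫⁻ t in Set.Ici (0 : ℝ), ‖nabla t w ω‖ₑ *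
          ∫⁻ s in block t, ‖nabla s x ω‖ₑ ^ 2) ∂P) := by
  rw [lintegral_setLIntegral_Ici_nabla (F := fun a b => a * b ^ 2) hmw hmx
      (measurable_fst.mul (measurable_snd.pow_const 2)),
    lintegral_setLIntegral_Ici_nabla_mul_setLIntegral_block hmx hmw, one_div, one_div,
    ENNReal.inv_mul_cancel_left two_ne_zero ENNReal.ofNat_ne_top,
    ENNReal.inv_mul_cancel_left four_ne_zero ENNReal.ofNat_ne_top, ← ENNReal.tsum_add]
  exact tsum_congr fun k => coordRemainder_eq unifs k hmx hx hmw

end Nabla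

end UniformSeq

end

theorem proposition3p3 (X : Lp ℝ 2 UniformSeq.P) (hX : X ∈ UniformSeq.DomNabla)
    (hX0 : ∫ ω, X ω ∂UniformSeq.P = 0) :
    -- the inner product `⟨∇X, -∇L⁻¹X⟩` of `L²(ℝ₊)` is almost surely a convergent integral
    (∀ᵐ ω ∂UniformSeq.P, IntegrableOn
      (fun t : ℝ => UniformSeq.nabla t X ω * -UniformSeq.nabla t (UniformSeq.Linv X) ω)
      (Set.Ici 0)) ∧
    UniformSeq.dW (UniformSeq.P.map X) (gaussianReal 0 1) ≤
      (∫⁻ ω, ‖1 - 1 / 2 * ∫ t in Set.Ici (0 : ℝ),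
          UniformSeq.nabla t X ω * -UniformSeq.nabla t (UniformSeq.Linv X) ω‖ₑ ∂UniformSeq.P)
      + 1 / 2 * (∫⁻ ω, (∫⁻ t in Set.Ici (0 : ℝ),
          ‖UniformSeq.nabla t (UniformSeq.Linv X) ω‖ₑ * ‖UniformSeq.nabla t X ω‖ₑ ^ 2)
          ∂UniformSeq.P)
      + 1 / 4 * (∫⁻ ω, (∫⁻ t in Set.Ici (0 : ℝ),
          ‖UniformSeq.nabla t (UniformSeq.Linv X) ω‖ₑ *
            ∫⁻ s in UniformSeq.block t, ‖UniformSeq.nabla s X ω‖ₑ ^ 2)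
          ∂UniformSeq.P) := by
  have hmX : Measurable X := (Lp.stronglyMeasurable X).measurable
  have hmW : Measurable (UniformSeq.Linv X) :=
    (Lp.stronglyMeasurable (UniformSeq.Linv X)).measurable
  have hW := UniformSeq.isOrnsteinUhlenbeckSolution_Linv hX0
  have hdiff := UniformSeq.tsum_lintegral_enorm_sq_coordDiff_lt_top hX
  have hint := UniformSeq.ae_integrableOn_nabla_mul hmX hmW
    (HoeffdingDecomposition.tsum_lintegral_coordDiff_mul_lt_top _ hmX hdiff
      hW.tsum_lintegral_enorm_sq_coordDiff_lt_top)
  refine ⟨hint, ?_⟩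
  rw [add_assoc, ← UniformSeq.tsum_coordRemainder hmX (Lp.memLp X) hmW]
  refine iSup₂_le fun h hh =>
    (hW.enorm_integral_map_sub_integral_gaussianReal_le hdiff hh).trans_eq ?_
  congr 1
  refine lintegral_congr_ae ?_
  filter_upwards [hint] with ω hω
  rw [UniformSeq.half_setIntegral_nabla_mul hω, sub_neg_eq_add]
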